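/- Let $n\ge 1$. Let $\mathbb S^n\subset\mathbb R^{n+1}$ be the unit sphere and $\mathbb H^n$ the hyperbolic space of curvature $-1$, with geodesic distance $d$. The gravitational attraction exerted at a point $p$ by a unit mass at a point $x$ is the tangent vector at $p$ of magnitude $G/\sin^{n-1} d(p,x)$ in $\mathbb S^n$, respectively $G/\sinh^{n-1} d(p,x)$ in $\mathbb H^n$ ($G$ a constant), directed along the (shortest) geodesic from $p$ to $x$; the gravitational field of a mass distribution is obtained by integrating the attraction. For $0<a\le b$, a uniform spherical shell with center $o$, inner radius $a$ and outer radius $b$ is a mass distribution of constant density $\rho\ge 0$: with respect to volume on $\{x : a\le d(o,x)\le b\}$ if $a<b$, and with respect to surface area on the sphere $\{x : d(o,x)=a\}$ if $a=b$ (infinitely thin shell). (1) The total mass of a uniform spherical shell in $\mathbb H^n$ is finite. The field created by the shell is zero at every point $p$ with $d(o,p)<a$ (the region bounded by the shell). At every point $p$ with $d(o,p)>b$ it is the same as the field created by the total mass of the shell concentrated at the center $o$. (2) Let a uniform spherical shell in $\mathbb S^n$ be such that $a+b\le\pi$, that is, the ball $\{d(o,p)<a\}$ is not larger than the other region bounded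 by the shell, $\{d(o,p)>b\}$. Its total mass is finite. The field created by the shell is zero at every point $p$ with $d(o,p)<a$ and at every point $p$ of the antipodal region $d(-o,p)<a$. At every point $p$ between the shell and its antipode, that is, with $d(o,p)>b$ and $d(-o,p)>b$, it is the same as the field created by the total mass of the shell concentrated at the center $o$. In all these cases the integral defining the field converges absolutely. -/

import Mathlib

open MeasureTheory
open scoped NNReal ENNReal RealInnerProductSpace

noncomputable section

/-! ### The sphere `S^n` -/

/-- The unit sphere `S^n` in `ℝ^{n+1}`. -/
abbrev Sph (n : ℕ) : Type := Metric.sphere (0 : EuclideanSpace ℝ (Fin (n + 1))) 1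

/-- The intrinsic (geodesic) distance on `S^n`, with values in `[0, π]`. -/
def sphDist {n : ℕ} (x y : Sph n) : ℝ :=
  InnerProductGeometry.angle (x : EuclideanSpace ℝ (Fin (n + 1))) y

/-- For `d = sphDist p x ∈ (0, π)`: the unit tangent vector at `p` of the shortest geodesic from `p`
to `x`, that is, the vector `w` orthogonal to `p` with `x = cos d • p + sin d • w`. -/
def sphDir {n : ℕ} (p x : Sph n) : EuclideanSpace ℝ (Fin (n + 1)) :=
  (Real.sin (sphDist p x))⁻¹ • ((x : EuclideanSpace ℝ (Fin (n + 1))) -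
    Real.cos (sphDist p x) • (p : EuclideanSpace ℝ (Fin (n + 1))))

/-- The attraction at `p` by a unit mass at `x`: of magnitude `G / sin^{n-1} d`, `d` the distance,
directed along the shortest geodesic from `p` to `x`. -/
def sphAttraction {n : ℕ} (G : ℝ) (p x : Sph n) : EuclideanSpace ℝ (Fin (n + 1)) :=
  (G / Real.sin (sphDist p x) ^ (n - 1)) • sphDir p x

/-- The gravitational field at `p` (a vector of `T_p S^n ⊆ ℝ^{n+1}`) of a mass distribution. -/
def sphField {n : ℕ} (G : ℝ) (μ : Measure (Sph n)) (p : Sph n) : EuclideanSpace ℝ (Fin (n + 1)) :=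
  ∫ x, sphAttraction G p x ∂μ

/-- The Riemannian volume of `S^n`. -/
def sphVolume (n : ℕ) : Measure (Sph n) :=
  (volume : Measure (EuclideanSpace ℝ (Fin (n + 1)))).toSphere

/-- An isometric linear identification of `ℝ^n` with the tangent space `T_o S^n = o^⊥`. -/
structure SphFrame {n : ℕ} (o : Sph n) where
  toLin : EuclideanSpace ℝ (Fin n) →ₗᵢ[ℝ] EuclideanSpace ℝ (Fin (n + 1))
  orth : ∀ v, ⟪(o : EuclideanSpace ℝ (Fin (n + 1))), toLin v⟫ = 0

instance sphFrame_nonempty {n : ℕ} (o : Sph n) : Nonempty (SphFrame o) := by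
  have ho : (o : EuclideanSpace ℝ (Fin (n + 1))) ≠ 0 := ne_zero_of_mem_unit_sphere o
  have : Fact (Module.finrank ℝ (EuclideanSpace ℝ (Fin (n + 1))) = n + 1) := ⟨by simp⟩
  let e := ((stdOrthonormalBasis ℝ (ℝ ∙ (o : EuclideanSpace ℝ (Fin (n + 1))))ᗮ).reindex
    (finCongr (Submodule.finrank_orthogonal_span_singleton (n := n) ho))).repr.symm
  exact ⟨⟨(Submodule.subtypeₗᵢ _).comp e.toLinearIsometry, fun v =>
    Submodule.mem_orthogonal_singleton_iff_inner_right.1 (e v).2⟩⟩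

/-- The point at distance `r` from `o` along the geodesic with initial unit vector `L v`. -/
def sphExp {n : ℕ} {o : Sph n} (L : SphFrame o) (r : ℝ)
    (v : Metric.sphere (0 : EuclideanSpace ℝ (Fin n)) 1) : Sph n :=
  ⟨Real.cos r • (o : EuclideanSpace ℝ (Fin (n + 1))) + Real.sin r • L.toLin v, by
    have ho : ‖(o : EuclideanSpace ℝ (Fin (n + 1)))‖ = 1 := by simp
    have hv : ‖(v : EuclideanSpace ℝ (Fin n))‖ = 1 := by simp
    have h : ‖Real.cos r • (o : EuclideanSpace ℝ (Fin (n + 1))) + Real.sin r • L.toLin v‖ ^ 2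
        = 1 := by
      rw [norm_add_sq_real, norm_smul, norm_smul, inner_smul_left, inner_smul_right, L.orth,
        L.toLin.norm_map, ho, hv]
      simp
    have h0 := norm_nonneg (Real.cos r • (o : EuclideanSpace ℝ (Fin (n + 1)))
      + Real.sin r • L.toLin v)
    rw [mem_sphere_zero_iff_norm]
    nlinarith⟩

/-- The `(n-1)`-dimensional surface measure of the geodesic sphere of radius `r ∈ (0, π)` and
center `o` in `S^n`: this sphere is the image of the unit sphere of `T_o S^n` under
`v ↦ cos r • o + sin r • v`, which multiplies lengths by `sin r`. It does not depend on `L`. -/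
def sphSurface {n : ℕ} {o : Sph n} (L : SphFrame o) (r : ℝ) : Measure (Sph n) :=
  ENNReal.ofReal (Real.sin r ^ (n - 1)) •
    (volume : Measure (EuclideanSpace ℝ (Fin n))).toSphere.map (sphExp L r)

/-- `μ` is the mass distribution of a uniform spherical shell in `S^n` with center `o`, inner radius
`a` and outer radius `b`: either `a < b` and `μ` has constant density with respect to volume on
`{x | a ≤ dist o x ≤ b}`, or `a = b` and the shell is an infinitely thin one, with constant density
with respect to surface area. -/
def IsUniformSphShell {n : ℕ} (o : Sph n) (a b : ℝ) (μ : Measure (Sph n)) : Prop :=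
  (a < b ∧ ∃ ρ : ℝ≥0, μ = ρ • (sphVolume n).restrict {x | a ≤ sphDist o x ∧ sphDist o x ≤ b}) ∨
    (a = b ∧ ∃ (ρ : ℝ≥0) (L : SphFrame o), μ = ρ • sphSurface L a)

/-! ### The hyperbolic space `H^n` -/

/-- The Minkowski scalar product of `ℝ^{n,1}`, with the time coordinate written first. -/
def mink {n : ℕ} (x y : ℝ × EuclideanSpace ℝ (Fin n)) : ℝ := -(x.1 * y.1) + ⟪x.2, y.2⟫

/-- Hyperbolic space `H^n`: the upper sheet of the hyperboloid `⟨x, x⟩ = -1`. -/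
abbrev Hyp (n : ℕ) : Type := {x : ℝ × EuclideanSpace ℝ (Fin n) // 0 < x.1 ∧ mink x x = -1}

/-- The hyperbolic distance: `cosh (dist x y) = -⟨x, y⟩`. -/
def hypDist {n : ℕ} (x y : Hyp n) : ℝ := Real.arcosh (-mink x.1 y.1)

/-- For `d = hypDist p x > 0`: the unit tangent vector at `p` of the geodesic from `p` to `x`, that
is, the vector `w` Minkowski-orthogonal to `p` with `x = cosh d • p + sinh d • w`. -/
def hypDir {n : ℕ} (p x : Hyp n) : ℝ × EuclideanSpace ℝ (Fin n) :=
  (Real.sinh (hypDist p x))⁻¹ • (x.1 - Real.cosh (hypDist p x) • p.1)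

/-- The attraction at `p` by a unit mass at `x`: of magnitude `G / sinh^{n-1} d`, `d` the distance,
directed along the geodesic from `p` to `x`. -/
def hypAttraction {n : ℕ} (G : ℝ) (p x : Hyp n) : ℝ × EuclideanSpace ℝ (Fin n) :=
  (G / Real.sinh (hypDist p x) ^ (n - 1)) • hypDir p x

/-- The gravitational field at `p` (a vector of `T_p H^n ⊆ ℝ^{n,1}`) of a mass distribution. -/
def hypField {n : ℕ} (G : ℝ) (μ : Measure (Hyp n)) (p : Hyp n) : ℝ × EuclideanSpace ℝ (Fin n) :=
  ∫ x, hypAttraction G p x ∂μ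

/-- The global chart `ℝ^n → H^n`, `x ↦ (√(1 + |x|²), x)`. -/
def hypChart {n : ℕ} (x : EuclideanSpace ℝ (Fin n)) : Hyp n :=
  ⟨(Real.sqrt (1 + ‖x‖ ^ 2), x), by positivity, by
    have h : (0 : ℝ) ≤ 1 + ‖x‖ ^ 2 := by positivity
    simp only [mink, Real.mul_self_sqrt h, real_inner_self_eq_norm_sq]
    ring⟩

/-- The Riemannian volume of `H^n`: in the chart `hypChart` the metric is
`|dx|² - ⟨x, dx⟩² / (1 + |x|²)`, with determinant `1 / (1 + |x|²)`. -/
def hypVolume (n : ℕ) : Measure (Hyp n) :=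
  ((volume : Measure (EuclideanSpace ℝ (Fin n))).withDensity
    fun x => ENNReal.ofReal (1 / Real.sqrt (1 + ‖x‖ ^ 2))).map hypChart

/-- An isometric linear identification of `ℝ^n` with the tangent space `T_o H^n`, the
Minkowski-orthogonal complement of `o`. -/
structure HypFrame {n : ℕ} (o : Hyp n) where
  toLin : EuclideanSpace ℝ (Fin n) →ₗ[ℝ] ℝ × EuclideanSpace ℝ (Fin n)
  isom : ∀ v w, mink (toLin v) (toLin w) = ⟪v, w⟫
  orth : ∀ v, mink o.1 (toLin v) = 0

instance hypFrame_nonempty {n : ℕ} (o : Hyp n) : Nonempty (HypFrame o) := by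
  obtain ⟨⟨t, x⟩, ht, h⟩ := o
  simp only at ht
  have h1 : (1 + t) ≠ 0 := by positivity
  have hx : ⟪x, x⟫ = t ^ 2 - 1 := by
    simp only [mink] at h
    linarith
  refine ⟨⟨⟨⟨fun v => (⟪x, v⟫, v + (⟪x, v⟫ / (1 + t)) • x), fun v w => ?_⟩, fun c v => ?_⟩,
    fun v w => ?_, fun v => ?_⟩⟩
  · ext1
    · simp [inner_add_right]
    · simp only [inner_add_right, Prod.mk_add_mk]
      module
  · ext1
    · simp [inner_smul_right]
    · simp only [real_inner_smul_right, RingHom.id_apply, Prod.smul_mk]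
      module
  · simp only [mink, LinearMap.coe_mk, AddHom.coe_mk, inner_add_left, inner_add_right,
      real_inner_smul_left, real_inner_smul_right, hx, real_inner_comm x v]
    field_simp
    ring
  · simp only [mink, LinearMap.coe_mk, AddHom.coe_mk, inner_add_right,
      real_inner_smul_right, hx]
    field_simp
    ring

/-- The point at distance `r` from `o` along the geodesic with initial unit vector `L v`. -/
def hypExp {n : ℕ} {o : Hyp n} (L : HypFrame o) (r : ℝ)
    (v : Metric.sphere (0 : EuclideanSpace ℝ (Fin n)) 1) : Hyp n :=
  ⟨Real.cosh r • o.1 + Real.sinh r • L.toLin v, by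
    obtain ⟨ho, hoo⟩ := o.2
    have hv : ‖(v : EuclideanSpace ℝ (Fin n))‖ = 1 := by simp
    have hvv := L.isom v v
    have hov := L.orth v
    rw [real_inner_self_eq_norm_sq, hv] at hvv
    have hX : mink (Real.cosh r • o.1 + Real.sinh r • L.toLin v)
        (Real.cosh r • o.1 + Real.sinh r • L.toLin v) = -1 := by
      have : mink (Real.cosh r • o.1 + Real.sinh r • L.toLin v)
          (Real.cosh r • o.1 + Real.sinh r • L.toLin v) = Real.cosh r ^ 2 * mink o.1 o.1
          + 2 * Real.cosh r * Real.sinh r * mink o.1 (L.toLin v)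
          + Real.sinh r ^ 2 * mink (L.toLin v) (L.toLin v) := by
        simp only [mink, Prod.fst_add, Prod.snd_add, Prod.smul_fst, Prod.smul_snd, smul_eq_mul,
          inner_add_left, inner_add_right, real_inner_smul_left, real_inner_smul_right,
          real_inner_comm o.1.2 (L.toLin v).2]
        ring
      rw [this, hoo, hov, hvv]
      nlinarith [Real.cosh_sq r]
    have hoX : mink o.1 (Real.cosh r • o.1 + Real.sinh r • L.toLin v) = -Real.cosh r := by
      have : mink o.1 (Real.cosh r • o.1 + Real.sinh r • L.toLin v) = Real.cosh r * mink o.1 o.1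
          + Real.sinh r * mink o.1 (L.toLin v) := by
        simp only [mink, Prod.fst_add, Prod.snd_add, Prod.smul_fst, Prod.smul_snd, smul_eq_mul,
          inner_add_right, real_inner_smul_right]
        ring
      rw [this, hoo, hov]
      ring
    refine ⟨?_, hX⟩
    generalize Real.cosh r • o.1 + Real.sinh r • L.toLin v = X at hX hoX ⊢
    by_contra hneg
    push Not at hneg
    have hc := Real.cosh_pos r
    have hi := real_inner_le_norm (-o.1.2) X.2
    rw [norm_neg, inner_neg_left] at hi
    simp only [mink, real_inner_self_eq_norm_sq] at hoo hX hoX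
    have h1 : ‖o.1.2‖ ≤ o.1.1 := by
      apply le_of_sq_le_sq _ ho.le
      nlinarith
    have h2 : ‖X.2‖ ≤ -X.1 := by
      apply le_of_sq_le_sq _ (by linarith)
      nlinarith
    have h3 := mul_le_mul h1 h2 (norm_nonneg _) ho.le
    nlinarith⟩

/-- The `(n-1)`-dimensional surface measure of the geodesic sphere of radius `r > 0` and center `o`
in `H^n`: this sphere is the image of the unit sphere of `T_o H^n` under
`v ↦ cosh r • o + sinh r • v`, which multiplies lengths by `sinh r`. It does not depend on `L`. -/
def hypSurface {n : ℕ} {o : Hyp n} (L : HypFrame o) (r : ℝ) : Measure (Hyp n) :=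
  ENNReal.ofReal (Real.sinh r ^ (n - 1)) •
    (volume : Measure (EuclideanSpace ℝ (Fin n))).toSphere.map (hypExp L r)

/-- `μ` is the mass distribution of a uniform spherical shell in `H^n` with center `o`, inner radius
`a` and outer radius `b`: either `a < b` and `μ` has constant density with respect to volume on
`{x | a ≤ dist o x ≤ b}`, or `a = b` and the shell is an infinitely thin one, with constant density
with respect to surface area. -/
def IsUniformHypShell {n : ℕ} (o : Hyp n) (a b : ℝ) (μ : Measure (Hyp n)) : Prop :=
  (a < b ∧ ∃ ρ : ℝ≥0, μ = ρ • (hypVolume n).restrict {x | a ≤ hypDist o x ∧ hypDist o x ≤ b}) ∨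
    (a = b ∧ ∃ (ρ : ℝ≥0) (L : HypFrame o), μ = ρ • hypSurface L a)

end

/-!
Write `(C, S, κ)` for `(cos, sin, 1)` on the sphere and `(cosh, sinh, -1)` on the hyperbolic space,
and treat both geometries at once (`IsTrigPair`). Let `s` be the distance from the center `o` of
the shell to the point `p`, let `e` be the direction of `p` seen from `o`, and let `x` be the point
at distance `r` in the direction `v`. With `u = ⟨v, e⟩` the law of cosines gives
`c = C(r) C(s) + κ S(r) S(s) u` for the (hyperbolic) cosine of the distance from `p` to `x` and
`D = κ (1 - c ^ 2)` for the square of its sine. The attraction at `p` by a mass at `x` is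
`D ^ (-n / 2) (x - c p)`, up to the constant `G`. After integration over the unit sphere of
directions `v` only its component along the geodesic through `o` and `p` survives, and this
component is the integral of `N D ^ (-n / 2)`, where `N = S(r) C(s) u - C(r) S(s)`
(`IsTrigPair.integral_attraction`).

The theorem rests on the identity `∫ ((1 - u ^ 2) f'(u) - (n - 1) u f(u)) dv = 0`, the divergence
theorem on the unit sphere for the field `f(u) e^T` (`integral_divergence_eq_zero`); it follows from
rotation invariance.

* The derivative in `r` of `N D ^ (-n / 2)` is the integrand of this identity for
  `f = c D ^ (-n / 2)`. So, as long as `r < s` (and `r + s < π` on the sphere), the integral does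
  not depend on `r`, and the sphere of radius `r` attracts like the sphere of radius zero
  (`IsTrigPair.zonalAttraction_outside`).
* The derivative in `s` of `S(s) ^ (n - 1) N D ^ (-n / 2)` is a multiple of that integrand for
  `f = D ^ (-n / 2)`. So `S(s) ^ (n - 1)` times the integral does not depend on `s < r`, and for
  `s = 0` the integral vanishes since its integrand is odd in `v`
  (`IsTrigPair.zonalAttraction_inside`).

Thick shells are superpositions of thin ones, by integration in geodesic polar coordinates
(`sphVolume_eq_map`, `hypVolume_eq_map`). These come from one change of variables in `ℝ × ℝ^n`
(`IsTrigPair.lintegral_cone`): the volume of the sphere is a cone measure, and so is the volume of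
hyperbolic space, on the future cone of Minkowski space. In the second case this also shows that the
volume, defined in a chart, has the same expression in the polar coordinates around every center,
since Lorentz transformations have determinant `±1`. On the sphere, the antipodal region reduces to
the inner one: the attractions at `p` and `-p` are the same vector.
-/

noncomputable section

open Set Metric


/-! ### Integration over the unit sphere -/

section UnitSphere

variable {E : Type*} [NormedAddCommGroup E] [InnerProductSpace ℝ E] [FiniteDimensional ℝ E]
  [MeasurableSpace E] [BorelSpace E]

/-- Integration in polar coordinates. -/
theorem lintegral_polar [Nontrivial E] {f : E → ℝ≥0∞} (hf : Measurable f) :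
    ∫⁻ x, f x = ∫⁻ v : sphere (0 : E) 1, (∫⁻ R in Ioi (0 : ℝ),
      ENNReal.ofReal (R ^ (Module.finrank ℝ E - 1)) * f (R • (v : E)))
      ∂(volume : Measure E).toSphere := by
  have h1 : ∫⁻ x, f x = ∫⁻ x : ({(0 : E)}ᶜ : Set E), f x ∂((volume : Measure E).comap (↑)) := by
    rw [lintegral_subtype_comap (measurableSet_singleton _).compl f, restrict_compl_singleton]
  have h2 := (volume : Measure E).measurePreserving_homeomorphUnitSphereProd.lintegral_comp
    (f := fun q : sphere (0 : E) 1 × Ioi (0 : ℝ) => f (q.2.1 • (q.1 : E))) (by fun_prop)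
  have h3 : ∀ x : ({(0 : E)}ᶜ : Set E),
      (fun q : sphere (0 : E) 1 × Ioi (0 : ℝ) => f (q.2.1 • (q.1 : E)))
        (homeomorphUnitSphereProd E x) = f x := by
    intro x
    have hx : ‖(x : E)‖ ≠ 0 := norm_ne_zero_iff.2 x.2
    simp [smul_smul, hx]
  simp only [h3] at h2
  rw [h1, h2, lintegral_prod _ (by fun_prop)]
  refine lintegral_congr fun v => ?_
  rw [Measure.volumeIoiPow, lintegral_withDensity_eq_lintegral_mul _ (by fun_prop) (by fun_prop)]
  simp only [Pi.mul_apply]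
  exact lintegral_subtype_comap measurableSet_Ioi
    (fun R : ℝ => ENNReal.ofReal (R ^ (Module.finrank ℝ E - 1)) * f (R • (v : E)))

omit [FiniteDimensional ℝ E] [MeasurableSpace E] [BorelSpace E] in
theorem exists_eq_norm_smul_sphere [Nontrivial E] (y : E) :
    ∃ e : sphere (0 : E) 1, y = ‖y‖ • (e : E) := by
  rcases eq_or_ne y 0 with rfl | hy
  · obtain ⟨e, he⟩ := NormedSpace.sphere_nonempty (E := E) (x := 0).2 zero_le_one
    exact ⟨⟨e, he⟩, by simp⟩
  · refine ⟨⟨‖y‖⁻¹ • y, ?_⟩, (smul_inv_smul₀ (norm_ne_zero_iff.2 hy) y).symm⟩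
    rw [mem_sphere_zero_iff_norm, norm_smul, norm_inv, norm_norm,
      inv_mul_cancel₀ (norm_ne_zero_iff.2 hy)]

/-- The action of a linear isometry on the unit sphere. -/
def sphereMap (T : E ≃ₗᵢ[ℝ] E) (v : sphere (0 : E) 1) : sphere (0 : E) 1 :=
  ⟨T v, by simp⟩

omit [FiniteDimensional ℝ E] in
theorem measurable_sphereMap (T : E ≃ₗᵢ[ℝ] E) : Measurable (sphereMap T) :=
  (T.continuous.measurable.comp measurable_subtype_coe).subtype_mk

theorem measurePreserving_sphereMap (T : E ≃ₗᵢ[ℝ] E) :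
    MeasurePreserving (sphereMap T) (volume : Measure E).toSphere
      (volume : Measure E).toSphere := by
  refine ⟨measurable_sphereMap T, Measure.ext fun s hs => ?_⟩
  rw [Measure.map_apply (measurable_sphereMap T) hs, Measure.toSphere_apply' _ hs,
    Measure.toSphere_apply' _ (measurable_sphereMap T hs)]
  congr 1
  symm
  rw [← T.measurePreserving.measure_preimage_equiv (f := T.toHomeomorph.toMeasurableEquiv)]
  congr 1
  ext x
  simp only [mem_smul, mem_image, mem_preimage]
  constructor
  · rintro ⟨R, hR, _, ⟨v, hv, rfl⟩, hx⟩
    refine ⟨R, hR, _, ⟨sphereMap T.symm v, ?_, rfl⟩, T.injective ?_⟩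
    · convert hv
      ext
      simp [sphereMap]
    · refine Eq.trans ?_ hx
      simp [sphereMap]
  · rintro ⟨R, hR, _, ⟨v, hv, rfl⟩, rfl⟩
    exact ⟨R, hR, _, ⟨_, hv, rfl⟩, (T.map_smul R (v : E)).symm⟩

theorem integral_sphereMap {F : Type*} [NormedAddCommGroup F] [NormedSpace ℝ F]
    (T : E ≃ₗᵢ[ℝ] E) (h : sphere (0 : E) 1 → F) (hh : Continuous h) :
    ∫ v, h (sphereMap T v) ∂(volume : Measure E).toSphere
      = ∫ v, h v ∂(volume : Measure E).toSphere := by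
  have h1 := (measurePreserving_sphereMap T).map_eq
  conv_rhs => rw [← h1]
  rw [integral_map (measurable_sphereMap T).aemeasurable hh.aestronglyMeasurable]

theorem Continuous.integrable_toSphere {F : Type*} [NormedAddCommGroup F]
    {h : sphere (0 : E) 1 → F} (hh : Continuous h) :
    Integrable h (volume : Measure E).toSphere := by
  rw [← integrableOn_univ]
  exact hh.continuousOn.integrableOn_compact isCompact_univ

/-- Differentiation under the integral sign, in integrated form. -/
theorem integral_sub_integral_eq_integral_deriv {X : Type*} [TopologicalSpace X]
    [CompactSpace X] [T2Space X] [MeasurableSpace X] [OpensMeasurableSpace X]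
    [SecondCountableTopology X] {μ : Measure X} [IsFiniteMeasure μ] {F F' : ℝ → X → ℝ} {a b : ℝ}
    (hab : a ≤ b)
    (hF : ∀ t ∈ Icc a b, Continuous (F t))
    (hd : ∀ t ∈ Icc a b, ∀ x, HasDerivAt (fun t => F t x) (F' t x) t)
    (hF' : ContinuousOn (Function.uncurry F') (Icc a b ×ˢ univ)) :
    ∫ x, F b x ∂μ - ∫ x, F a x ∂μ = ∫ t in a..b, ∫ x, F' t x ∂μ := by
  have hint : ∀ t ∈ Icc a b, Integrable (F t) μ := fun t ht => by
    rw [← integrableOn_univ]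
    exact (hF t ht).continuousOn.integrableOn_compact isCompact_univ
  rw [← integral_sub (hint b (right_mem_Icc.2 hab)) (hint a (left_mem_Icc.2 hab))]
  have h1 : ∀ x, F b x - F a x = ∫ t in a..b, F' t x := by
    intro x
    rw [intervalIntegral.integral_eq_sub_of_hasDerivAt (f := fun t => F t x)]
    · intro t ht
      rw [uIcc_of_le hab] at ht
      exact hd t ht x
    · apply ContinuousOn.intervalIntegrable
      rw [uIcc_of_le hab]
      exact hF'.comp (f := fun t => (t, x)) (by fun_prop) fun t ht => ⟨ht, mem_univ _⟩
  simp only [h1, intervalIntegral.integral_of_le hab]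
  rw [integral_integral_swap]
  have h2 : IntegrableOn (Function.uncurry F') (Icc a b ×ˢ univ)
      ((volume : Measure ℝ).prod μ) :=
    hF'.integrableOn_compact (isCompact_Icc.prod isCompact_univ)
  have h3 : Integrable (Function.uncurry F') ((volume.restrict (Ioc a b)).prod μ) := by
    have : (volume.restrict (Ioc a b)).prod μ
        = ((volume : Measure ℝ).prod μ).restrict (Ioc a b ×ˢ univ) := by
      rw [← Measure.prod_restrict, Measure.restrict_univ]
    rw [this]
    exact h2.mono_set (prod_mono Ioc_subset_Icc_self subset_rfl)
  exact h3.swap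

omit [MeasurableSpace E] [BorelSpace E] in
/-- The rotation by the angle `θ` in the plane spanned by two orthonormal vectors. -/
theorem exists_rotation {e e' : E} (he : ‖e‖ = 1) (he' : ‖e'‖ = 1) (hee : ⟪e, e'⟫ = 0) (θ : ℝ) :
    ∃ T : E ≃ₗᵢ[ℝ] E, ∀ v, ⟪T v, e⟫ = Real.cos θ * ⟪v, e⟫ - Real.sin θ * ⟪v, e'⟫ ∧
      ⟪T v, e'⟫ = Real.sin θ * ⟪v, e⟫ + Real.cos θ * ⟪v, e'⟫ := by
  have h1 : ⟪e, e⟫ = (1 : ℝ) := by rw [real_inner_self_eq_norm_sq, he, one_pow]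
  have h2 : ⟪e', e'⟫ = (1 : ℝ) := by rw [real_inner_self_eq_norm_sq, he', one_pow]
  have h3 : ⟪e', e⟫ = (0 : ℝ) := by rw [real_inner_comm, hee]
  have hcs := Real.sin_sq_add_cos_sq θ
  let A : E →ₗ[ℝ] E :=
    { toFun := fun v => v + ((Real.cos θ - 1) * ⟪v, e⟫ - Real.sin θ * ⟪v, e'⟫) • e
        + (Real.sin θ * ⟪v, e⟫ + (Real.cos θ - 1) * ⟪v, e'⟫) • e'
      map_add' := fun v w => by
        simp only [inner_add_left]
        module
      map_smul' := fun c v => by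
        simp only [real_inner_smul_left, RingHom.id_apply]
        module }
  have hA : ∀ v, ‖A v‖ = ‖v‖ := fun v => by
    have : ‖A v‖ ^ 2 = ‖v‖ ^ 2 := by
      rw [← real_inner_self_eq_norm_sq, ← real_inner_self_eq_norm_sq]
      simp only [A, LinearMap.coe_mk, AddHom.coe_mk, inner_add_left, inner_add_right,
        real_inner_smul_left, real_inner_smul_right, h1, h2, h3, hee]
      rw [real_inner_comm v e, real_inner_comm v e']
      linear_combination (⟪v, e⟫ ^ 2 + ⟪v, e'⟫ ^ 2) * hcs
    exact (sq_eq_sq₀ (norm_nonneg _) (norm_nonneg _)).1 this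
  refine ⟨(⟨A, hA⟩ : E →ₗᵢ[ℝ] E).toLinearIsometryEquiv rfl, fun v => ?_⟩
  simp only [LinearIsometry.coe_toLinearIsometryEquiv, LinearIsometry.coe_mk, A, LinearMap.coe_mk,
    AddHom.coe_mk, inner_add_left, real_inner_smul_left, h1, h2, h3, hee]
  constructor <;> ring

omit [FiniteDimensional ℝ E] [MeasurableSpace E] [BorelSpace E] in
theorem inner_mem_Icc {e : E} (he : ‖e‖ = 1) (v : sphere (0 : E) 1) :
    ⟪(v : E), e⟫ ∈ Icc (-1 : ℝ) 1 := by
  have := abs_real_inner_le_norm (v : E) e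
  rw [he, norm_eq_of_mem_sphere v, one_mul] at this
  exact abs_le.1 this

/-- The infinitesimal form of the invariance of the integral of `⟨v, e'⟩ f(⟨v, e⟩)` under the
rotations in the plane spanned by `e` and `e'`. -/
theorem integral_rotation_eq_zero {e e' : E} (he : ‖e‖ = 1) (he' : ‖e'‖ = 1) (hee : ⟪e, e'⟫ = 0)
    {f f' : ℝ → ℝ} (hf : ∀ u ∈ Icc (-1 : ℝ) 1, HasDerivAt f (f' u) u)
    (hf' : ContinuousOn f' (Icc (-1) 1)) :
    ∫ v : sphere (0 : E) 1, (⟪(v : E), e'⟫ ^ 2 * f' ⟪(v : E), e⟫ - ⟪(v : E), e⟫ * f ⟪(v : E), e⟫)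
      ∂(volume : Measure E).toSphere = 0 := by
  choose T hT using exists_rotation he he' hee
  have hmem := inner_mem_Icc (E := E) he
  have hfc : ContinuousOn f (Icc (-1) 1) := fun u hu => (hf u hu).continuousAt.continuousWithinAt
  obtain ⟨X, hXd⟩ : ∃ X : ℝ → sphere (0 : E) 1 → ℝ, ∀ θ v,
    X θ v = Real.cos θ * ⟪(v : E), e⟫ - Real.sin θ * ⟪(v : E), e'⟫ := ⟨_, fun _ _ => rfl⟩
  obtain ⟨Y, hYd⟩ : ∃ Y : ℝ → sphere (0 : E) 1 → ℝ, ∀ θ v,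
    Y θ v = Real.sin θ * ⟪(v : E), e⟫ + Real.cos θ * ⟪(v : E), e'⟫ := ⟨_, fun _ _ => rfl⟩
  have hX : ∀ θ v, ⟪(sphereMap (T θ) v : E), e⟫ = X θ v := fun θ v => (hXd θ v) ▸ (hT θ v).1
  have hY : ∀ θ v, ⟪(sphereMap (T θ) v : E), e'⟫ = Y θ v := fun θ v => (hYd θ v) ▸ (hT θ v).2
  have hXm : ∀ θ v, X θ v ∈ Icc (-1 : ℝ) 1 := fun θ v => hX θ v ▸ hmem _
  have hX0 : ∀ v : sphere (0 : E) 1, X 0 v = ⟪(v : E), e⟫ := fun v => by simp [hXd]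
  have hY0 : ∀ v : sphere (0 : E) 1, Y 0 v = ⟪(v : E), e'⟫ := fun v => by simp [hYd]
  have hXc : Continuous (Function.uncurry X) := by
    simp only [hXd, Function.uncurry_def]
    fun_prop
  have hYc : Continuous (Function.uncurry Y) := by
    simp only [hYd, Function.uncurry_def]
    fun_prop
  have hfX : Continuous fun q : ℝ × sphere (0 : E) 1 => f (X q.1 q.2) :=
    hfc.comp_continuous hXc fun q => hXm _ _
  have hfX' : Continuous fun q : ℝ × sphere (0 : E) 1 => f' (X q.1 q.2) :=
    hf'.comp_continuous hXc fun q => hXm _ _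
  obtain ⟨F, hFd⟩ : ∃ F : ℝ → sphere (0 : E) 1 → ℝ, ∀ θ v, F θ v = Y θ v * f (X θ v) :=
    ⟨_, fun _ _ => rfl⟩
  obtain ⟨F', hFd'⟩ : ∃ F' : ℝ → sphere (0 : E) 1 → ℝ, ∀ θ v,
    F' θ v = X θ v * f (X θ v) - Y θ v ^ 2 * f' (X θ v) := ⟨_, fun _ _ => rfl⟩
  have hFc : Continuous (Function.uncurry F) := by
    simp only [Function.uncurry_def, hFd]
    exact hYc.mul hfX
  have hFc' : Continuous (Function.uncurry F') := by
    simp only [Function.uncurry_def, hFd']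
    exact (hXc.mul hfX).sub ((hYc.pow 2).mul hfX')
  have key := integral_sub_integral_eq_integral_deriv (μ := (volume : Measure E).toSphere)
    (F := F) (F' := F') (zero_le_one' ℝ) (fun t _ => hFc.comp (Continuous.prodMk_right t))
    (fun t _ v => by
      have h1 : HasDerivAt (fun t => X t v) (-Y t v) t := by
        simp only [hXd]
        refine (((Real.hasDerivAt_cos t).mul_const _).sub
          ((Real.hasDerivAt_sin t).mul_const _)).congr_deriv ?_
        simp only [hYd]
        ring
      have h2 : HasDerivAt (fun t => Y t v) (X t v) t := by
        simp only [hYd]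
        refine (((Real.hasDerivAt_sin t).mul_const _).add
          ((Real.hasDerivAt_cos t).mul_const _)).congr_deriv ?_
        simp only [hXd]
        ring
      simp only [hFd, hFd']
      refine (h2.mul ((hf _ (hXm t v)).comp t h1)).congr_deriv ?_
      simp only [Function.comp_apply]
      ring) hFc'.continuousOn
  have h0 : ∀ t, Continuous (F t) := fun t => hFc.comp (Continuous.prodMk_right t)
  have h0' : ∀ t, Continuous (F' t) := fun t => hFc'.comp (Continuous.prodMk_right t)
  -- The integrals of `F θ` and `F' θ` do not depend on `θ`, by rotation invariance.
  have h1 : ∀ t, ∫ v, F t v ∂(volume : Measure E).toSphere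
      = ∫ v, F 0 v ∂(volume : Measure E).toSphere := fun t => by
    rw [← integral_sphereMap (T t) _ (h0 0)]
    simp only [hFd, hX0, hY0, hX, hY]
  have h2 : ∀ t, ∫ v, F' t v ∂(volume : Measure E).toSphere
      = ∫ v, F' 0 v ∂(volume : Measure E).toSphere := fun t => by
    rw [← integral_sphereMap (T t) _ (h0' 0)]
    simp only [hFd', hX0, hY0, hX, hY]
  simp only [h1, h2, sub_self, intervalIntegral.integral_const, sub_zero, one_smul] at key
  rw [← neg_eq_zero, ← integral_neg, key]
  simp only [hFd', hX0, hY0]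
  congr with v
  ring

/-- The divergence theorem on the unit sphere for the vector field `f(⟨v, e⟩) e^T`, where `e^T` is
the tangential part of `e`. It is the sum of the identities `integral_rotation_eq_zero` over an
orthonormal basis `e'` of the orthogonal complement of `e`. -/
theorem integral_divergence_eq_zero {e : E} (he : ‖e‖ = 1)
    {f f' : ℝ → ℝ} (hf : ∀ u ∈ Icc (-1 : ℝ) 1, HasDerivAt f (f' u) u)
    (hf' : ContinuousOn f' (Icc (-1) 1)) :
    ∫ v : sphere (0 : E) 1, ((1 - ⟪(v : E), e⟫ ^ 2) * f' ⟪(v : E), e⟫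
      - (Module.finrank ℝ E - 1) * (⟪(v : E), e⟫ * f ⟪(v : E), e⟫))
      ∂(volume : Measure E).toSphere = 0 := by
  classical
  have hmem := inner_mem_Icc (E := E) he
  have hfc : ContinuousOn f (Icc (-1) 1) := fun u hu => (hf u hu).continuousAt.continuousWithinAt
  have hon : Orthonormal ℝ ((↑) : ({e} : Set E) → E) := by
    refine ⟨fun x => ?_, fun x y hxy => (hxy (Subsingleton.elim x y)).elim⟩
    rw [show (x : E) = e from x.2, he]
  obtain ⟨u, b, heu, hb⟩ := hon.exists_orthonormalBasis_extension
  let i₀ : u := ⟨e, heu rfl⟩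
  have hbi : b i₀ = e := by rw [hb]
  have hsum : ∀ v : sphere (0 : E) 1,
      ∑ i ∈ Finset.univ.erase i₀, ⟪(v : E), b i⟫ ^ 2 = 1 - ⟪(v : E), e⟫ ^ 2 := fun v => by
    have h1 := b.sum_sq_norm_inner_right (v : E)
    rw [norm_eq_of_mem_sphere v, ← Finset.add_sum_erase _ _ (Finset.mem_univ i₀)] at h1
    simp only [hbi, Real.norm_eq_abs, sq_abs] at h1
    rw [eq_sub_iff_add_eq, add_comm]
    simpa only [real_inner_comm, one_pow] using h1
  have hcard : ((Finset.univ.erase i₀).card : ℝ) = Module.finrank ℝ E - 1 := by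
    rw [Finset.card_erase_of_mem (Finset.mem_univ _), Finset.card_univ,
      Module.finrank_eq_card_basis b.toBasis, Nat.cast_sub (Fintype.card_pos_iff.2 ⟨i₀⟩)]
    simp
  have hfX : Continuous fun v : sphere (0 : E) 1 => f ⟪(v : E), e⟫ :=
    hfc.comp_continuous (by fun_prop) hmem
  have hfX' : Continuous fun v : sphere (0 : E) 1 => f' ⟪(v : E), e⟫ :=
    hf'.comp_continuous (by fun_prop) hmem
  have h0 : ∑ i ∈ Finset.univ.erase i₀, ∫ v : sphere (0 : E) 1,
      (⟪(v : E), b i⟫ ^ 2 * f' ⟪(v : E), e⟫ - ⟪(v : E), e⟫ * f ⟪(v : E), e⟫)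
      ∂(volume : Measure E).toSphere = 0 := by
    refine Finset.sum_eq_zero fun i hi => ?_
    refine integral_rotation_eq_zero he (b.orthonormal.1 i) ?_ hf hf'
    rw [← hbi]
    exact b.orthonormal.2 (Finset.ne_of_mem_erase hi).symm
  have hc : ∀ i, Continuous fun v : sphere (0 : E) 1 =>
      ⟪(v : E), b i⟫ ^ 2 * f' ⟪(v : E), e⟫ - ⟪(v : E), e⟫ * f ⟪(v : E), e⟫ := fun i =>
    (Continuous.mul (by fun_prop) hfX').sub (Continuous.mul (by fun_prop) hfX)
  rw [← integral_finsetSum _ fun i _ => (hc i).integrable_toSphere] at h0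
  rw [← h0]
  congr with v
  rw [Finset.sum_sub_distrib, ← Finset.sum_mul, hsum, Finset.sum_const, nsmul_eq_mul, hcard]

/-- The mean over the unit sphere of a zonal function times the part of `v` orthogonal to the
axis vanishes, by symmetry under the half-turn about the axis. -/
theorem integral_zonal_smul_orthogonal_eq_zero {e : E} (he : ‖e‖ = 1) {φ : ℝ → ℝ}
    (hφ : ContinuousOn φ (Icc (-1) 1)) :
    ∫ v : sphere (0 : E) 1, φ ⟪(v : E), e⟫ • ((v : E) - ⟪(v : E), e⟫ • e)
      ∂(volume : Measure E).toSphere = 0 := by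
  let T := (ℝ ∙ e).reflection
  have hφc : Continuous fun v : sphere (0 : E) 1 => φ ⟪(v : E), e⟫ :=
    hφ.comp_continuous (by fun_prop) (inner_mem_Icc he)
  have hT : ∀ v : E, T v = (2 * ⟪v, e⟫) • e - v := fun v => by
    simp only [T]
    rw [Submodule.reflection_apply, Submodule.starProjection_unit_singleton ℝ he, real_inner_comm]
    module
  have hTe : ∀ v, ⟪T v, e⟫ = ⟪v, e⟫ := fun v => by
    rw [hT, inner_sub_left, real_inner_smul_left, real_inner_self_eq_norm_sq, he]
    ring
  have h := integral_sphereMap T (fun v => φ ⟪(v : E), e⟫ • ((v : E) - ⟪(v : E), e⟫ • e))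
    (hφc.smul (by fun_prop))
  have h' : ∀ v : sphere (0 : E) 1, φ ⟪(sphereMap T v : E), e⟫ •
      ((sphereMap T v : E) - ⟪(sphereMap T v : E), e⟫ • e)
      = -(φ ⟪(v : E), e⟫ • ((v : E) - ⟪(v : E), e⟫ • e)) := fun v => by
    simp only [sphereMap, hTe]
    rw [hT]
    module
  simp only [h', integral_neg] at h
  have h2 := add_eq_zero_iff_eq_neg.2 h.symm
  rw [← two_smul ℝ] at h2
  exact (smul_eq_zero.1 h2).resolve_left two_ne_zero

/-- The antipodal map preserves the measure, so odd functions have zero integral. -/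
theorem integral_odd_eq_zero {h : ℝ → ℝ} (hh : ContinuousOn h (Icc (-1) 1))
    (hodd : ∀ u, h (-u) = -h u) {e : E} (he : ‖e‖ = 1) :
    ∫ v : sphere (0 : E) 1, h ⟪(v : E), e⟫ ∂(volume : Measure E).toSphere = 0 := by
  have h1 := integral_sphereMap (LinearIsometryEquiv.neg ℝ)
    (fun v : sphere (0 : E) 1 => h ⟪(v : E), e⟫)
    (hh.comp_continuous (f := fun v : sphere (0 : E) 1 => ⟪(v : E), e⟫) (by fun_prop)
      (inner_mem_Icc he))
  simp only [sphereMap, LinearIsometryEquiv.coe_neg, inner_neg_left, hodd, integral_neg] at h1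
  linarith

end UnitSphere

/-! ### Trigonometry of a geodesic triangle -/

/-- The pair of functions `(cos, sin)` for `κ = 1` and `(cosh, sinh)` for `κ = -1`, characterized
by the properties used below. -/
structure IsTrigPair (κ : ℝ) (C S : ℝ → ℝ) : Prop where
  sq_curv : κ ^ 2 = 1
  map_zero_cos : C 0 = 1
  map_zero_sin : S 0 = 0
  pythagoras : ∀ r, C r ^ 2 + κ * S r ^ 2 = 1
  hasDerivAt_cos : ∀ r, HasDerivAt C (-κ * S r) r
  hasDerivAt_sin : ∀ r, HasDerivAt S (C r) r

theorem isTrigPair_sphere : IsTrigPair 1 Real.cos Real.sin where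
  sq_curv := by norm_num
  map_zero_cos := Real.cos_zero
  map_zero_sin := Real.sin_zero
  pythagoras r := by rw [one_mul, Real.cos_sq_add_sin_sq]
  hasDerivAt_cos r := (Real.hasDerivAt_cos r).congr_deriv (by ring)
  hasDerivAt_sin := Real.hasDerivAt_sin

theorem isTrigPair_hyperbolic : IsTrigPair (-1) Real.cosh Real.sinh where
  sq_curv := by norm_num
  map_zero_cos := Real.cosh_zero
  map_zero_sin := Real.sinh_zero
  pythagoras r := by linarith [Real.cosh_sq r]
  hasDerivAt_cos r := (Real.hasDerivAt_cosh r).congr_deriv (by ring)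
  hasDerivAt_sin := Real.hasDerivAt_sinh

/-- The law of cosines: the (hyperbolic) cosine of the side opposite to an angle with cosine `u`
between sides of lengths `r` and `s`. -/
def cosSide (κ : ℝ) (C S : ℝ → ℝ) (r s u : ℝ) : ℝ := C r * C s + κ * (S r * S s * u)

/-- The square of the (hyperbolic) sine of the side whose cosine is `cosSide κ C S r s u`. -/
def sinSqSide (κ : ℝ) (C S : ℝ → ℝ) (r s u : ℝ) : ℝ := κ * (1 - cosSide κ C S r s u ^ 2)

/-- The inverse of the `n`-th power of the (hyperbolic) sine of the third side. -/
def invSinPow (κ : ℝ) (C S : ℝ → ℝ) (n : ℕ) (r s u : ℝ) : ℝ := (√(sinSqSide κ C S r s u) ^ n)⁻¹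

/-- The component, in the direction of the axis through `o` and `p`, of the vector at `p` pointing
to `x` whose length is the (hyperbolic) sine of `d(p, x)`; here `r = d(o, x)`, `s = d(o, p)` and `u`
is the cosine of the angle at `o`. -/
def radialPart (C S : ℝ → ℝ) (r s u : ℝ) : ℝ := S r * C s * u - C r * S s

section Derivatives

variable {κ : ℝ} {C S : ℝ → ℝ}

theorem hasDerivAt_inv_sqrt_pow {D : ℝ → ℝ} {D' t : ℝ} (n : ℕ) (hD : HasDerivAt D D' t)
    (hpos : 0 < D t) :
    HasDerivAt (fun t => (√(D t) ^ n)⁻¹) (-(n / 2 * D' / D t) * (√(D t) ^ n)⁻¹) t := by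
  have hq : 0 < √(D t) := Real.sqrt_pos.2 hpos
  refine (((hD.sqrt hpos.ne').fun_pow n).fun_inv (pow_pos hq n).ne').congr_deriv ?_
  have h2 : D t = √(D t) ^ 2 := (Real.sq_sqrt hpos.le).symm
  cases n with
  | zero => simp
  | succ k =>
    have h3 : -((k + 1 : ℕ) / 2 * D' / D t) = -((k + 1 : ℕ) / 2 * D' / √(D t) ^ 2) := by rw [← h2]
    rw [Nat.add_sub_cancel, h3]
    field_simp
    ring

theorem IsTrigPair.continuous_cos (h : IsTrigPair κ C S) : Continuous C :=
  continuous_iff_continuousAt.2 fun r => (h.hasDerivAt_cos r).continuousAt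

theorem IsTrigPair.continuous_sin (h : IsTrigPair κ C S) : Continuous S :=
  continuous_iff_continuousAt.2 fun r => (h.hasDerivAt_sin r).continuousAt

theorem IsTrigPair.continuous_cosSide (h : IsTrigPair κ C S) :
    Continuous fun q : ℝ × ℝ × ℝ => cosSide κ C S q.1 q.2.1 q.2.2 := by
  have := h.continuous_cos
  have := h.continuous_sin
  unfold cosSide
  fun_prop

theorem IsTrigPair.continuous_radialPart (h : IsTrigPair κ C S) :
    Continuous fun q : ℝ × ℝ × ℝ => radialPart C S q.1 q.2.1 q.2.2 := by
  have := h.continuous_cos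
  have := h.continuous_sin
  unfold radialPart
  fun_prop

theorem IsTrigPair.continuous_sinSqSide (h : IsTrigPair κ C S) :
    Continuous fun q : ℝ × ℝ × ℝ => sinSqSide κ C S q.1 q.2.1 q.2.2 := by
  have := h.continuous_cosSide
  unfold sinSqSide
  fun_prop

theorem IsTrigPair.continuousOn_invSinPow (h : IsTrigPair κ C S) (n : ℕ) :
    ContinuousOn (fun q : ℝ × ℝ × ℝ => invSinPow κ C S n q.1 q.2.1 q.2.2)
      {q | 0 < sinSqSide κ C S q.1 q.2.1 q.2.2} := by
  have := h.continuous_sinSqSide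
  unfold invSinPow
  refine ContinuousOn.inv₀ (by fun_prop) fun q hq => (pow_pos (Real.sqrt_pos.2 hq) n).ne'

theorem IsTrigPair.radialPart_mul_radialPart (h : IsTrigPair κ C S) (r s u : ℝ) :
    radialPart C S r s u * radialPart C S s r u
      = (1 - u ^ 2) * cosSide κ C S r s u * (S r * S s) - u * sinSqSide κ C S r s u := by
  have hr := h.pythagoras r
  have hs := h.pythagoras s
  have hκ := h.sq_curv
  simp only [radialPart, cosSide, sinSqSide]
  linear_combination (-u * κ) * ((C r ^ 2 + κ * S r ^ 2) * hs + hr)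
    + (u * (S r ^ 2 * C s ^ 2 + C r ^ 2 * S s ^ 2) + u * κ * (S r ^ 2 * S s ^ 2)
      - 2 * u ^ 2 * (C r * C s * S r * S s) - u ^ 3 * κ * (S r ^ 2 * S s ^ 2)) * hκ

/-- Pythagoras for the vector of length `sin d(p, x)` pointing from `p` to `x`. -/
theorem IsTrigPair.sinSqSide_eq (h : IsTrigPair κ C S) (r s u : ℝ) :
    sinSqSide κ C S r s u = radialPart C S r s u ^ 2 + (1 - u ^ 2) * S r ^ 2 := by
  have hr := h.pythagoras r
  have hs := h.pythagoras s
  have hκ := h.sq_curv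
  simp only [radialPart, cosSide, sinSqSide]
  linear_combination (-u ^ 2 * S r ^ 2 - κ * C r ^ 2) * hs - κ * hr
    + (C r ^ 2 * S s ^ 2 + S r ^ 2 - 2 * u * (C r * C s * S r * S s)
      - u ^ 2 * κ * (S r ^ 2 * S s ^ 2)) * hκ

theorem IsTrigPair.cos_mul_radialPart (h : IsTrigPair κ C S) (r s u : ℝ) :
    C s * radialPart C S r s u + S s * cosSide κ C S r s u = u * S r := by
  simp only [radialPart, cosSide]
  linear_combination (u * S r) * h.pythagoras s

/-- The derivative in `r` of the radial attraction is the divergence integrand of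
`integral_divergence_eq_zero` for the function `cosSide * invSinPow`. -/
theorem IsTrigPair.hasDerivAt_radialPart_fst (h : IsTrigPair κ C S) (n : ℕ) {r s u : ℝ}
    (hpos : 0 < sinSqSide κ C S r s u) :
    HasDerivAt (fun r => radialPart C S r s u * invSinPow κ C S n r s u)
      ((1 - u ^ 2) * ((κ * (S r * S s) + n * cosSide κ C S r s u ^ 2 * (S r * S s)
          / sinSqSide κ C S r s u) * invSinPow κ C S n r s u)
        - (n - 1) * (u * (cosSide κ C S r s u * invSinPow κ C S n r s u))) r := by
  have hC := h.hasDerivAt_cos r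
  have hS := h.hasDerivAt_sin r
  have hc : HasDerivAt (fun r => cosSide κ C S r s u) (κ * radialPart C S s r u) r :=
    ((hC.mul_const _).add (((hS.mul_const _).mul_const _).const_mul _)).congr_deriv (by
      simp only [radialPart]
      ring)
  have hD : HasDerivAt (fun r => sinSqSide κ C S r s u)
      (-(2 * cosSide κ C S r s u * radialPart C S s r u)) r :=
    (((hc.fun_pow 2).const_sub 1).const_mul κ).congr_deriv (by
      linear_combination (-(2 * cosSide κ C S r s u * radialPart C S s r u)) * h.sq_curv)
  have hN : HasDerivAt (fun r => radialPart C S r s u)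
      ((1 - u ^ 2) * (κ * (S r * S s)) + u * cosSide κ C S r s u) r :=
    (((hS.mul_const _).mul_const _).sub (hC.mul_const _)).congr_deriv (by
      simp only [cosSide]
      ring)
  refine (hN.mul (hasDerivAt_inv_sqrt_pow n hD hpos)).congr_deriv ?_
  rw [← invSinPow]
  have key := h.radialPart_mul_radialPart r s u
  have hD0 := hpos.ne'
  generalize invSinPow κ C S n r s u = W at *
  generalize sinSqSide κ C S r s u = D at *
  field_simp
  linear_combination (n * cosSide κ C S r s u * W) * key

theorem IsTrigPair.hasDerivAt_invSinPow (h : IsTrigPair κ C S) (n : ℕ) {r s u : ℝ}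
    (hpos : 0 < sinSqSide κ C S r s u) :
    HasDerivAt (fun u => invSinPow κ C S n r s u)
      (n * cosSide κ C S r s u * (S r * S s) / sinSqSide κ C S r s u
        * invSinPow κ C S n r s u) u := by
  have hc : HasDerivAt (fun u => cosSide κ C S r s u) (κ * (S r * S s)) u :=
    ((((hasDerivAt_id u).const_mul _).const_mul κ).const_add _).congr_deriv (by ring)
  have hD : HasDerivAt (fun u => sinSqSide κ C S r s u)
      (-(2 * cosSide κ C S r s u * (S r * S s))) u :=
    (((hc.fun_pow 2).const_sub 1).const_mul κ).congr_deriv (by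
      linear_combination (-(2 * cosSide κ C S r s u * (S r * S s))) * h.sq_curv)
  refine (hasDerivAt_inv_sqrt_pow n hD hpos).congr_deriv ?_
  rw [← invSinPow]
  ring

theorem IsTrigPair.hasDerivAt_cosSide_mul_invSinPow (h : IsTrigPair κ C S) (n : ℕ) {r s u : ℝ}
    (hpos : 0 < sinSqSide κ C S r s u) :
    HasDerivAt (fun u => cosSide κ C S r s u * invSinPow κ C S n r s u)
      ((κ * (S r * S s) + n * cosSide κ C S r s u ^ 2 * (S r * S s)
          / sinSqSide κ C S r s u) * invSinPow κ C S n r s u) u := by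
  have hc : HasDerivAt (fun u => cosSide κ C S r s u) (κ * (S r * S s)) u :=
    ((((hasDerivAt_id u).const_mul _).const_mul κ).const_add _).congr_deriv (by ring)
  exact (hc.mul (h.hasDerivAt_invSinPow n hpos)).congr_deriv (by ring)

/-- The derivative in `s` of `S(s) ^ m` times the radial attraction. For `m = n - 1` it is a
multiple of the divergence integrand of `integral_divergence_eq_zero` for the function
`invSinPow`. -/
theorem IsTrigPair.hasDerivAt_radialPart_snd (h : IsTrigPair κ C S) (m : ℕ) {r s u : ℝ}
    (hpos : 0 < sinSqSide κ C S r s u) :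
    HasDerivAt (fun s => S s ^ m * (radialPart C S r s u * invSinPow κ C S (m + 1) r s u))
      (-S r * (S s ^ m * ((1 - u ^ 2) * ((m + 1 : ℕ) * cosSide κ C S r s u * S r
          / sinSqSide κ C S r s u * invSinPow κ C S (m + 1) r s u))
        - m * S s ^ (m - 1) * (u * invSinPow κ C S (m + 1) r s u))) s := by
  have hC := h.hasDerivAt_cos s
  have hS := h.hasDerivAt_sin s
  have hc : HasDerivAt (fun s => cosSide κ C S r s u) (κ * radialPart C S r s u) s :=
    ((hC.const_mul _).add (((hS.const_mul _).mul_const _).const_mul _)).congr_deriv (by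
      simp only [radialPart]
      ring)
  have hD : HasDerivAt (fun s => sinSqSide κ C S r s u)
      (-(2 * cosSide κ C S r s u * radialPart C S r s u)) s :=
    (((hc.fun_pow 2).const_sub 1).const_mul κ).congr_deriv (by
      linear_combination (-(2 * cosSide κ C S r s u * radialPart C S r s u)) * h.sq_curv)
  have hN : HasDerivAt (fun s => radialPart C S r s u) (-cosSide κ C S r s u) s :=
    (((hC.const_mul _).mul_const _).sub (hS.const_mul _)).congr_deriv (by
      simp only [cosSide]
      ring)
  refine ((hS.fun_pow m).mul (hN.fun_mul (hasDerivAt_inv_sqrt_pow (m + 1) hD hpos))).congr_deriv ?_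
  rw [← invSinPow]
  have key := h.sinSqSide_eq r s u
  have key2 := h.cos_mul_radialPart r s u
  have hD0 := hpos.ne'
  have hm : m * S s ^ (m - 1) * S s = m * S s ^ m := by
    cases m with
    | zero => simp
    | succ k =>
      rw [Nat.add_sub_cancel]
      ring
  generalize invSinPow κ C S (m + 1) r s u = W at *
  generalize sinSqSide κ C S r s u = D at *
  generalize cosSide κ C S r s u = c at *
  generalize radialPart C S r s u = N at *
  generalize S s ^ (m - 1) = Q at *
  push_cast
  field_simp
  linear_combination (m * Q * D * W) * key2 - ((m + 1) * S s ^ m * c * W) * key - c * W * D * hm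

end Derivatives

/-! ### The attraction of a geodesic sphere -/

section ShellIntegral

variable {κ : ℝ} {C S : ℝ → ℝ}
variable {E : Type*} [NormedAddCommGroup E] [InnerProductSpace ℝ E] [FiniteDimensional ℝ E]
  [MeasurableSpace E] [BorelSpace E]

/-- The radial component of the field at distance `s` from `o` created by the geodesic sphere of
radius `r` and center `o`, up to the factor `S(r) ^ (n - 1)`, as an integral over the unit sphere of
the tangent space `E` at `o`; the unit vector `e` points from `o` to `p`. -/
def zonalAttraction (κ : ℝ) (C S : ℝ → ℝ) (e : E) (r s : ℝ) : ℝ :=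
  ∫ v : sphere (0 : E) 1, radialPart C S r s ⟪(v : E), e⟫
    * invSinPow κ C S (Module.finrank ℝ E) r s ⟪(v : E), e⟫ ∂(volume : Measure E).toSphere

theorem IsTrigPair.continuousOn_invSinPow_arg (h : IsTrigPair κ C S) (n : ℕ) {r s : ℝ}
    (hpos : ∀ u ∈ Icc (-1 : ℝ) 1, 0 < sinSqSide κ C S r s u) :
    ContinuousOn (fun u => invSinPow κ C S n r s u) (Icc (-1) 1) :=
  (h.continuousOn_invSinPow n).comp (f := fun u => (r, s, u)) (by fun_prop) fun u hu => hpos u hu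

omit [FiniteDimensional ℝ E] [MeasurableSpace E] [BorelSpace E] in
theorem IsTrigPair.continuous_invSinPow_sphere (h : IsTrigPair κ C S) (n : ℕ) {e : E} (he : ‖e‖ = 1)
    {r s : ℝ} (hpos : ∀ u ∈ Icc (-1 : ℝ) 1, 0 < sinSqSide κ C S r s u) :
    Continuous fun v : sphere (0 : E) 1 => invSinPow κ C S n r s ⟪(v : E), e⟫ :=
  (h.continuousOn_invSinPow_arg n hpos).comp_continuous (by fun_prop) (inner_mem_Icc he)

theorem IsTrigPair.continuous_zonalAttraction_integrand (h : IsTrigPair κ C S) (n : ℕ) {e : E}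
    (he : ‖e‖ = 1) {r s : ℝ} (hpos : ∀ u ∈ Icc (-1 : ℝ) 1, 0 < sinSqSide κ C S r s u) :
    Continuous fun v : sphere (0 : E) 1 =>
      radialPart C S r s ⟪(v : E), e⟫ * invSinPow κ C S n r s ⟪(v : E), e⟫ :=
  Continuous.mul (h.continuous_radialPart.comp
    (f := fun v : sphere (0 : E) 1 => (r, s, ⟪(v : E), e⟫)) (by fun_prop))
    (h.continuous_invSinPow_sphere n he hpos)

/-- As long as the point `p` stays outside, the zonal integral does not depend on the radius of the
shell, so that the shell can be shrunk to its center. -/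
theorem IsTrigPair.zonalAttraction_outside (h : IsTrigPair κ C S) {e : E} (he : ‖e‖ = 1) {r s : ℝ}
    (hr : 0 ≤ r) (hs : 0 < S s)
    (hpos : ∀ t ∈ Icc 0 r, ∀ u ∈ Icc (-1 : ℝ) 1, 0 < sinSqSide κ C S t s u) :
    zonalAttraction κ C S e r s = -((volume : Measure E).toSphere.real univ
      * (S s * (S s ^ Module.finrank ℝ E)⁻¹)) := by
  set n := Module.finrank ℝ E with hn
  have hmem := inner_mem_Icc (E := E) he
  have hCc := h.continuous_cos
  have hSc := h.continuous_sin
  have hcont : ContinuousOn (fun q : ℝ × ℝ => invSinPow κ C S n q.1 s q.2)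
      (Icc 0 r ×ˢ Icc (-1) 1) :=
    (h.continuousOn_invSinPow n).comp (f := fun q : ℝ × ℝ => (q.1, s, q.2)) (by fun_prop)
      fun q hq => hpos _ hq.1 _ hq.2
  have hcos : Continuous fun q : ℝ × ℝ => cosSide κ C S q.1 s q.2 :=
    h.continuous_cosSide.comp (f := fun q : ℝ × ℝ => (q.1, s, q.2)) (by fun_prop)
  have hsin : Continuous fun q : ℝ × ℝ => sinSqSide κ C S q.1 s q.2 :=
    h.continuous_sinSqSide.comp (f := fun q : ℝ × ℝ => (q.1, s, q.2)) (by fun_prop)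
  have hf' : ContinuousOn (fun q : ℝ × ℝ => (κ * (S q.1 * S s) + n * cosSide κ C S q.1 s q.2 ^ 2
      * (S q.1 * S s) / sinSqSide κ C S q.1 s q.2) * invSinPow κ C S n q.1 s q.2)
      (Icc 0 r ×ˢ Icc (-1) 1) :=
    ContinuousOn.mul (ContinuousOn.add (by fun_prop) (ContinuousOn.div (by fun_prop) (by fun_prop)
      fun q hq => (hpos _ hq.1 _ hq.2).ne')) hcont
  have hint : ContinuousOn (fun q : ℝ × ℝ =>
      (1 - q.2 ^ 2) * ((κ * (S q.1 * S s) + n * cosSide κ C S q.1 s q.2 ^ 2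
      * (S q.1 * S s) / sinSqSide κ C S q.1 s q.2) * invSinPow κ C S n q.1 s q.2)
      - (n - 1) * (q.2 * (cosSide κ C S q.1 s q.2 * invSinPow κ C S n q.1 s q.2)))
      (Icc 0 r ×ˢ Icc (-1) 1) :=
    ContinuousOn.sub (ContinuousOn.mul (by fun_prop) hf')
      (ContinuousOn.mul (by fun_prop) (ContinuousOn.mul (by fun_prop)
        (ContinuousOn.mul (by fun_prop) hcont)))
  have key := integral_sub_integral_eq_integral_deriv (μ := (volume : Measure E).toSphere)
    (F := fun t v => radialPart C S t s ⟪(v : E), e⟫ * invSinPow κ C S n t s ⟪(v : E), e⟫)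
    (F' := _) hr (fun t ht => h.continuous_zonalAttraction_integrand n he (hpos t ht))
    (fun t ht v => h.hasDerivAt_radialPart_fst n (hpos t ht _ (hmem v)))
    (hint.comp (f := fun q : ℝ × sphere (0 : E) 1 => (q.1, ⟪(q.2 : E), e⟫)) (by fun_prop)
      fun q hq => ⟨hq.1, hmem _⟩)
  have hzero : ∀ t ∈ Icc 0 r, _ := fun t ht =>
    integral_divergence_eq_zero he
      (fun u hu => h.hasDerivAt_cosSide_mul_invSinPow n (hpos t ht u hu))
      (hf'.comp (f := fun u => (t, u)) (by fun_prop) fun u hu => ⟨ht, hu⟩)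
  rw [intervalIntegral.integral_congr (g := fun _ => (0 : ℝ))
    (fun t ht => hzero t (by rwa [uIcc_of_le hr] at ht)), intervalIntegral.integral_zero,
    sub_eq_zero] at key
  rw [zonalAttraction, ← hn, key]
  have h0 : ∀ u, sinSqSide κ C S 0 s u = S s ^ 2 := fun u => by
    simp only [sinSqSide, cosSide, h.map_zero_cos, h.map_zero_sin]
    linear_combination S s ^ 2 * h.sq_curv - κ * h.pythagoras s
  simp only [invSinPow, h0, radialPart, h.map_zero_cos, h.map_zero_sin, Real.sqrt_sq hs.le,
    zero_mul, one_mul, zero_sub, integral_const, smul_eq_mul]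
  ring

/-- As long as the point `p` stays inside, `S(s) ^ (n - 1)` times the zonal integral does not depend
on the position of `p`, and it vanishes when `p` is at the center. -/
theorem IsTrigPair.zonalAttraction_inside (h : IsTrigPair κ C S) [Nontrivial E] {e : E}
    (he : ‖e‖ = 1) {r s : ℝ} (hs : 0 ≤ s) (hS : ∀ t ∈ Ioc 0 s, S t ≠ 0)
    (hpos : ∀ t ∈ Icc 0 s, ∀ u ∈ Icc (-1 : ℝ) 1, 0 < sinSqSide κ C S r t u) :
    zonalAttraction κ C S e r s = 0 := by
  obtain ⟨m, hm⟩ : ∃ m, Module.finrank ℝ E = m + 1 :=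
    ⟨_, (Nat.succ_pred_eq_of_pos Module.finrank_pos).symm⟩
  have hmem := inner_mem_Icc (E := E) he
  have hCc := h.continuous_cos
  have hSc := h.continuous_sin
  have hzero : zonalAttraction κ C S e r 0 = 0 := by
    refine integral_odd_eq_zero (h := fun u => radialPart C S r 0 u
      * invSinPow κ C S (Module.finrank ℝ E) r 0 u) (ContinuousOn.mul ?_
        (h.continuousOn_invSinPow_arg _ (hpos 0 (left_mem_Icc.2 hs)))) (fun u => ?_) he
    · exact (h.continuous_radialPart.comp (f := fun u : ℝ => (r, (0 : ℝ), u))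
        (by fun_prop)).continuousOn
    · simp [radialPart, invSinPow, sinSqSide, cosSide, h.map_zero_sin]
  rcases hs.eq_or_lt with rfl | hs0
  · exact hzero
  have hcont : ContinuousOn (fun q : ℝ × ℝ => invSinPow κ C S (m + 1) r q.1 q.2)
      (Icc 0 s ×ˢ Icc (-1) 1) :=
    (h.continuousOn_invSinPow _).comp (f := fun q : ℝ × ℝ => (r, q.1, q.2)) (by fun_prop)
      fun q hq => hpos _ hq.1 _ hq.2
  have hcos : Continuous fun q : ℝ × ℝ => cosSide κ C S r q.1 q.2 :=
    h.continuous_cosSide.comp (f := fun q : ℝ × ℝ => (r, q.1, q.2)) (by fun_prop)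
  have hsin : Continuous fun q : ℝ × ℝ => sinSqSide κ C S r q.1 q.2 :=
    h.continuous_sinSqSide.comp (f := fun q : ℝ × ℝ => (r, q.1, q.2)) (by fun_prop)
  have hquot : ContinuousOn (fun q : ℝ × ℝ => (m + 1 : ℕ) * cosSide κ C S r q.1 q.2 * S r
      / sinSqSide κ C S r q.1 q.2 * invSinPow κ C S (m + 1) r q.1 q.2)
      (Icc 0 s ×ˢ Icc (-1) 1) :=
    ContinuousOn.mul (ContinuousOn.div (by fun_prop) (by fun_prop)
      fun q hq => (hpos _ hq.1 _ hq.2).ne') hcont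
  have hint : ContinuousOn (fun q : ℝ × ℝ =>
      -S r * (S q.1 ^ m * ((1 - q.2 ^ 2) * ((m + 1 : ℕ) * cosSide κ C S r q.1 q.2 * S r
          / sinSqSide κ C S r q.1 q.2 * invSinPow κ C S (m + 1) r q.1 q.2))
        - m * S q.1 ^ (m - 1) * (q.2 * invSinPow κ C S (m + 1) r q.1 q.2)))
      (Icc 0 s ×ˢ Icc (-1) 1) :=
    ContinuousOn.mul (by fun_prop) (ContinuousOn.sub
      (ContinuousOn.mul (by fun_prop) (ContinuousOn.mul (by fun_prop) hquot))
      (ContinuousOn.mul (by fun_prop) (ContinuousOn.mul (by fun_prop) hcont)))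
  have key := integral_sub_integral_eq_integral_deriv (μ := (volume : Measure E).toSphere)
    (F := fun t v => S t ^ m * (radialPart C S r t ⟪(v : E), e⟫
      * invSinPow κ C S (m + 1) r t ⟪(v : E), e⟫))
    (F' := _) hs
    (fun t ht => continuous_const.mul
      (h.continuous_zonalAttraction_integrand (m + 1) he (hpos t ht)))
    (fun t ht v => h.hasDerivAt_radialPart_snd m (hpos t ht _ (hmem v)))
    (hint.comp (f := fun q : ℝ × sphere (0 : E) 1 => (q.1, ⟪(q.2 : E), e⟫)) (by fun_prop)
      fun q hq => ⟨hq.1, hmem _⟩)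
  have hdiv : ∀ t ∈ Ioc 0 s, ∫ v : sphere (0 : E) 1,
      -S r * (S t ^ m * ((1 - ⟪(v : E), e⟫ ^ 2) * ((m + 1 : ℕ) * cosSide κ C S r t ⟪(v : E), e⟫
          * S r / sinSqSide κ C S r t ⟪(v : E), e⟫ * invSinPow κ C S (m + 1) r t ⟪(v : E), e⟫))
        - m * S t ^ (m - 1) * (⟪(v : E), e⟫ * invSinPow κ C S (m + 1) r t ⟪(v : E), e⟫))
      ∂(volume : Measure E).toSphere = 0 := fun t ht => by
    have hS0 := hS t ht
    have ht' := Ioc_subset_Icc_self ht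
    have h0 := integral_divergence_eq_zero he
      (fun u hu => h.hasDerivAt_invSinPow (m + 1) (hpos t ht' u hu))
      (((hquot.comp (f := fun u => (t, u)) (by fun_prop) fun u hu => ⟨ht', hu⟩).const_mul
        (S t)).congr fun u hu => by
          simp only [Function.comp_apply]
          ring)
    have hm' : m * S t ^ (m - 1) = m * S t ^ m / S t := by
      rw [eq_div_iff hS0]
      cases m with
      | zero => simp
      | succ k =>
        rw [Nat.add_sub_cancel]
        ring
    rw [← mul_zero (-S r * S t ^ m / S t), ← h0, ← integral_const_mul]
    congr with v
    rw [hm', hm]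
    push_cast
    field_simp
    ring
  rw [intervalIntegral.integral_of_le hs, setIntegral_congr_fun measurableSet_Ioc hdiv,
    integral_zero, sub_eq_zero, integral_const_mul, integral_const_mul, ← hm] at key
  change S s ^ m * zonalAttraction κ C S e r s = S 0 ^ m * zonalAttraction κ C S e r 0 at key
  rw [hzero, mul_zero] at key
  exact (mul_eq_zero.1 key).resolve_left (pow_ne_zero _ (hS s (right_mem_Ioc.2 hs0)))

/-- The integral over a geodesic sphere of the attraction is directed along the geodesic through `o`
and `p`. Here `p = C(s) o + S(s) L e`, a point of the geodesic sphere is `C(r) o + S(r) L v`, and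
`C(s) L e - κ S(s) o` is the unit tangent vector at `p` pointing away from `o`. -/
theorem IsTrigPair.integral_attraction (h : IsTrigPair κ C S) {V : Type*} [NormedAddCommGroup V]
    [NormedSpace ℝ V] [CompleteSpace V] (L : E →ₗ[ℝ] V) (o : V) {e : E} (he : ‖e‖ = 1) {r s : ℝ}
    (hpos : ∀ u ∈ Icc (-1 : ℝ) 1, 0 < sinSqSide κ C S r s u) :
    ∫ v : sphere (0 : E) 1, invSinPow κ C S (Module.finrank ℝ E) r s ⟪(v : E), e⟫ •
      (C r • o + S r • L v - cosSide κ C S r s ⟪(v : E), e⟫ • (C s • o + S s • L e))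
      ∂(volume : Measure E).toSphere
    = zonalAttraction κ C S e r s • (C s • L e - (κ * S s) • o) := by
  have hs := h.pythagoras s
  have hdec : ∀ v : sphere (0 : E) 1, invSinPow κ C S (Module.finrank ℝ E) r s ⟪(v : E), e⟫ •
      (C r • o + S r • L v - cosSide κ C S r s ⟪(v : E), e⟫ • (C s • o + S s • L e))
      = (radialPart C S r s ⟪(v : E), e⟫ * invSinPow κ C S (Module.finrank ℝ E) r s ⟪(v : E), e⟫)
          • (C s • L e - (κ * S s) • o)
        + S r • L (invSinPow κ C S (Module.finrank ℝ E) r s ⟪(v : E), e⟫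
          • ((v : E) - ⟪(v : E), e⟫ • e)) := fun v => by
    simp only [map_smul, map_sub]
    generalize ⟪(v : E), e⟫ = u
    have h1 : cosSide κ C S r s u * C s = C r + κ * S s * radialPart C S r s u := by
      simp only [cosSide, radialPart]
      linear_combination C r * hs
    have h2 : cosSide κ C S r s u * S s = S r * u - C s * radialPart C S r s u := by
      simp only [cosSide, radialPart]
      linear_combination u * S r * hs
    rw [smul_add (cosSide κ C S r s u), smul_smul, smul_smul, h1, h2]
    module
  have hW := h.continuous_invSinPow_sphere (Module.finrank ℝ E) he hpos
  have hi : Continuous fun v : sphere (0 : E) 1 =>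
      invSinPow κ C S (Module.finrank ℝ E) r s ⟪(v : E), e⟫ • ((v : E) - ⟪(v : E), e⟫ • e) :=
    hW.smul (by fun_prop)
  have hL : Continuous L := L.continuous_of_finiteDimensional
  simp only [hdec]
  rw [integral_add, integral_smul_const, integral_smul, zonalAttraction]
  · have := L.toContinuousLinearMap.integral_comp_comm hi.integrable_toSphere
    simp only [LinearMap.coe_toContinuousLinearMap'] at this
    rw [this, integral_zonal_smul_orthogonal_eq_zero he
      (h.continuousOn_invSinPow_arg _ hpos), map_zero, smul_zero, add_zero]
  · exact ((h.continuous_zonalAttraction_integrand _ he hpos).smul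
      continuous_const).integrable_toSphere
  · exact ((hL.comp hi).const_smul (S r)).integrable_toSphere

end ShellIntegral

/-! ### Geodesic polar coordinates -/

section GeodesicPolar

variable {κ : ℝ} {C S : ℝ → ℝ}
variable {E : Type*} [NormedAddCommGroup E] [InnerProductSpace ℝ E] [FiniteDimensional ℝ E]
  [MeasurableSpace E] [BorelSpace E]

/-- The volume of a space form in geodesic polar coordinates `(r, v)`, where `r` ranges over `J` and
`v` over the unit sphere of the tangent space `E`: the density is `S(r) ^ (n - 1)`. -/
def polarMeasure (S : ℝ → ℝ) (J : Set ℝ) (E : Type*) [NormedAddCommGroup E]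
    [InnerProductSpace ℝ E] [FiniteDimensional ℝ E] [MeasurableSpace E] [BorelSpace E] :
    Measure (ℝ × sphere (0 : E) 1) :=
  ((volume.restrict J).withDensity fun r => ENNReal.ofReal (S r ^ (Module.finrank ℝ E - 1))).prod
    (volume : Measure E).toSphere

theorem lintegral_polarMeasure (hS : Continuous S) {J : Set ℝ}
    {f : ℝ × sphere (0 : E) 1 → ℝ≥0∞} (hf : Measurable f) :
    ∫⁻ q, f q ∂polarMeasure S J E = ∫⁻ r in J, ENNReal.ofReal (S r ^ (Module.finrank ℝ E - 1))
      * ∫⁻ v, f (r, v) ∂(volume : Measure E).toSphere := by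
  rw [polarMeasure, lintegral_prod _ hf.aemeasurable,
    lintegral_withDensity_eq_lintegral_mul _ (by fun_prop) hf.lintegral_prod_right']
  rfl

theorem lintegral_Ioi_comp_mul {c : ℝ} (hc : 0 < c) (g : ℝ → ℝ≥0∞) :
    ∫⁻ ρ in Ioi 0, g ρ = ∫⁻ R in Ioi 0, ENNReal.ofReal c * g (R * c) := by
  have himg : (fun R => R * c) '' Ioi 0 = Ioi 0 := by
    ext x
    constructor
    · rintro ⟨R, hR, rfl⟩
      exact mul_pos hR hc
    · intro hx
      exact ⟨x / c, div_pos hx hc, div_mul_cancel₀ x hc.ne'⟩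
  conv_lhs => rw [← himg]
  rw [lintegral_image_eq_lintegral_abs_deriv_mul measurableSet_Ioi
    (f' := fun _ => c)
    (fun x _ => ((hasDerivAt_id' x).mul_const c).congr_deriv (one_mul c) |>.hasDerivWithinAt)
    (fun x _ y _ h => mul_right_cancel₀ hc.ne' h)]
  simp [abs_of_pos hc]

/-- Polar coordinates in `ℝ × E` in which the time coordinate is `R C(r)` and the space coordinate
is `R S(r) v`: the slope of the time coordinate runs over `(C / S) '' J`. -/
theorem IsTrigPair.lintegral_cone (h : IsTrigPair κ C S) [Nontrivial E] {J B : Set ℝ}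
    (hJ : MeasurableSet J) (hpos : ∀ r ∈ J, 0 < S r) (hinj : InjOn (fun r => C r / S r) J)
    (hB : (fun r => C r / S r) '' J = B) (hBm : MeasurableSet B)
    {f : ℝ × E → ℝ≥0∞} (hf : Measurable f) :
    ∫⁻ q in {q : ℝ × E | q.1 / ‖q.2‖ ∈ B}, f q
      = ∫⁻ q, (∫⁻ R in Ioi 0, ENNReal.ofReal (R ^ Module.finrank ℝ E)
          * f (R * C q.1, (R * S q.1) • (q.2 : E))) ∂polarMeasure S J E := by
  obtain ⟨m, hm⟩ : ∃ m, Module.finrank ℝ E = m + 1 :=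
    ⟨_, (Nat.succ_pred_eq_of_pos Module.finrank_pos).symm⟩
  have hC := h.continuous_cos
  have hS := h.continuous_sin
  have hA : MeasurableSet {q : ℝ × E | q.1 / ‖q.2‖ ∈ B} :=
    (measurable_fst.div measurable_snd.norm) hBm
  have hderiv : ∀ ρ : ℝ, ∀ r ∈ J, HasDerivWithinAt (fun r => ρ * (C r / S r))
      (ρ * (-1 / S r ^ 2)) J r := fun ρ r hr =>
    ((((h.hasDerivAt_cos r).fun_div (h.hasDerivAt_sin r) (hpos r hr).ne').const_mul
      ρ).congr_deriv (by
        congr 2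
        linear_combination -h.pythagoras r)).hasDerivWithinAt
  -- For a fixed space coordinate `ρ v`, the time coordinate is parametrized as `ρ C(r) / S(r)`.
  have hinner : ∀ ρ ∈ Ioi (0 : ℝ), ∀ v : sphere (0 : E) 1,
      ∫⁻ t, {q : ℝ × E | q.1 / ‖q.2‖ ∈ B}.indicator f (t, ρ • (v : E))
        = ∫⁻ r in J, ENNReal.ofReal (ρ / S r ^ 2) * f (ρ * (C r / S r), ρ • (v : E)) := by
    intro ρ hρ v
    have hρ : 0 < ρ := hρ
    have himg : (fun r => ρ * (C r / S r)) '' J = {t | t / ρ ∈ B} := by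
      ext t
      rw [← hB]
      constructor
      · rintro ⟨r, hr, rfl⟩
        exact ⟨r, hr, by field_simp⟩
      · rintro ⟨r, hr, hrt⟩
        exact ⟨r, hr, by simp only at hrt ⊢; rw [hrt]; field_simp⟩
    have h1 : ∀ t, {q : ℝ × E | q.1 / ‖q.2‖ ∈ B}.indicator f (t, ρ • (v : E))
        = {t | t / ρ ∈ B}.indicator (fun t => f (t, ρ • (v : E))) t := fun t => by
      have hn : ‖ρ • (v : E)‖ = ρ := by
        rw [norm_smul, norm_eq_of_mem_sphere, Real.norm_eq_abs, abs_of_pos hρ, mul_one]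
      have hiff : (t, ρ • (v : E)) ∈ {q : ℝ × E | q.1 / ‖q.2‖ ∈ B} ↔ t ∈ {t | t / ρ ∈ B} := by
        change t / ‖ρ • (v : E)‖ ∈ B ↔ t / ρ ∈ B
        rw [hn]
      by_cases ht : t ∈ {t | t / ρ ∈ B}
      · rw [indicator_of_mem (hiff.2 ht), indicator_of_mem ht]
      · rw [indicator_of_notMem (mt hiff.1 ht), indicator_of_notMem ht]
    have hBρ : MeasurableSet {t | t / ρ ∈ B} := (measurable_id.div_const ρ) hBm
    simp only [h1]
    rw [lintegral_indicator hBρ, ← himg, lintegral_image_eq_lintegral_abs_deriv_mul hJ (hderiv ρ)]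
    · refine setLIntegral_congr_fun hJ fun r hr => ?_
      have := hpos r hr
      rw [abs_mul, abs_div, abs_neg, abs_one, abs_of_pos hρ, abs_of_pos (pow_pos this 2),
        mul_one_div]
    · intro x hx y hy hxy
      exact hinj hx hy (mul_left_cancel₀ hρ.ne' hxy)
  rw [← lintegral_indicator hA, Measure.volume_eq_prod,
    lintegral_prod_symm _ (hf.indicator hA).aemeasurable,
    lintegral_polar (Measurable.lintegral_prod_left' (hf.indicator hA)),
    lintegral_polarMeasure hS (by fun_prop)]
  have h2 : ∀ v : sphere (0 : E) 1, ∫⁻ ρ in Ioi (0 : ℝ),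
      ENNReal.ofReal (ρ ^ (Module.finrank ℝ E - 1))
        * ∫⁻ t, {q : ℝ × E | q.1 / ‖q.2‖ ∈ B}.indicator f (t, ρ • (v : E))
      = ∫⁻ r in J, ∫⁻ ρ in Ioi (0 : ℝ), ENNReal.ofReal (ρ ^ (m + 1) / S r ^ 2)
        * f (ρ * (C r / S r), ρ • (v : E)) := by
    intro v
    rw [lintegral_lintegral_swap (by fun_prop)]
    refine setLIntegral_congr_fun measurableSet_Ioi fun ρ hρ => ?_
    rw [hinner ρ hρ v, ← lintegral_const_mul _ (by fun_prop)]
    refine setLIntegral_congr_fun hJ fun r hr => ?_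
    rw [← mul_assoc, ← ENNReal.ofReal_mul (pow_nonneg (le_of_lt hρ) _), hm, Nat.add_sub_cancel]
    congr 2
    ring
  simp only [h2]
  rw [lintegral_lintegral_swap (by fun_prop)]
  refine setLIntegral_congr_fun hJ fun r hr => ?_
  have hr0 := hpos r hr
  rw [← lintegral_const_mul _ (by fun_prop)]
  refine lintegral_congr fun v => ?_
  rw [lintegral_Ioi_comp_mul hr0, ← lintegral_const_mul _ (by fun_prop)]
  refine setLIntegral_congr_fun measurableSet_Ioi fun R hR => ?_
  have hR : 0 < R := hR
  have e1 : S r * ((R * S r) ^ (m + 1) / S r ^ 2) = S r ^ m * R ^ (m + 1) := by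
    field_simp
    ring
  have e2 : R * S r * (C r / S r) = R * C r := by
    field_simp
  rw [← mul_assoc, ← mul_assoc, ← ENNReal.ofReal_mul hr0.le,
    ← ENNReal.ofReal_mul (pow_nonneg hr0.le _), hm, Nat.add_sub_cancel, e1, e2]

theorem lintegral_Ioi_pow_mul_indicator (n : ℕ) (c : ℝ≥0∞) :
    ∫⁻ R in Ioi (0 : ℝ), ENNReal.ofReal (R ^ n) * (if R < 1 then c else 0)
      = ((n + 1 : ℕ) : ℝ≥0∞)⁻¹ * c := by
  have h1 : ∀ R : ℝ, ENNReal.ofReal (R ^ n) * (if R < 1 then c else 0)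
      = (Iio 1).indicator (fun R => ENNReal.ofReal (R ^ n) * c) R := fun R => by
    by_cases hR : R < 1 <;> simp [hR]
  simp only [h1]
  rw [setLIntegral_indicator measurableSet_Iio, lintegral_mul_const _ (by fun_prop)]
  congr 1
  have h2 : Iio (1 : ℝ) ∩ Ioi 0 = Ioo 0 1 := by
    rw [inter_comm, Ioi_inter_Iio]
  rw [h2, Measure.restrict_congr_set Ioo_ae_eq_Ioc, ← ofReal_integral_eq_lintegral_ofReal
    (intervalIntegral.intervalIntegrable_pow n).1, ← intervalIntegral.integral_of_le zero_le_one,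
    integral_pow, one_pow, zero_pow n.succ_ne_zero, sub_zero, one_div, ENNReal.ofReal_inv_of_pos
    (by positivity)]
  · norm_cast
  · filter_upwards [ae_restrict_mem measurableSet_Ioc] with y hy
    exact pow_nonneg hy.1.le _

end GeodesicPolar

/-! ### The sphere -/

section Sphere

variable {n : ℕ}

theorem injOn_cot : InjOn (fun r => Real.cos r / Real.sin r) (Ioo 0 Real.pi) := by
  intro r hr s hs hrs
  have h1 := Real.sin_pos_of_mem_Ioo hr
  have h2 := Real.sin_pos_of_mem_Ioo hs
  have h3 : Real.sin (r - s) = 0 := by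
    rw [div_eq_div_iff h1.ne' h2.ne'] at hrs
    rw [Real.sin_sub]
    linarith
  have h4 := (Real.sin_eq_zero_iff_of_lt_of_lt (by linarith [hr.1, hs.2])
    (by linarith [hr.2, hs.1])).1 h3
  linarith

theorem image_cot : (fun r => Real.cos r / Real.sin r) '' Ioo 0 Real.pi = univ := by
  refine eq_univ_of_forall fun t => ⟨Real.pi / 2 - Real.arctan t, ⟨?_, ?_⟩, ?_⟩
  · linarith [Real.arctan_lt_pi_div_two t]
  · linarith [Real.neg_pi_div_two_lt_arctan t]
  · simp only
    rw [Real.cos_pi_div_two_sub, Real.sin_pi_div_two_sub, ← Real.tan_eq_sin_div_cos,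
      Real.tan_arctan]

theorem coe_sphExp {o : Sph n} (L : SphFrame o) (r : ℝ)
    (v : sphere (0 : EuclideanSpace ℝ (Fin n)) 1) :
    (sphExp L r v : EuclideanSpace ℝ (Fin (n + 1)))
      = Real.cos r • (o : EuclideanSpace ℝ (Fin (n + 1))) + Real.sin r • L.toLin v := rfl

theorem continuous_sphExp {o : Sph n} (L : SphFrame o) :
    Continuous (Function.uncurry (sphExp L)) := by
  have := L.toLin.continuous
  refine Continuous.subtype_mk ?_ _
  fun_prop

theorem inner_sphExp {o : Sph n} (L : SphFrame o) (r s : ℝ)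
    (v e : sphere (0 : EuclideanSpace ℝ (Fin n)) 1) :
    ⟪(sphExp L r v : EuclideanSpace ℝ (Fin (n + 1))), sphExp L s e⟫
      = cosSide 1 Real.cos Real.sin r s ⟪(v : EuclideanSpace ℝ (Fin n)), e⟫ := by
  have ho : ⟪(o : EuclideanSpace ℝ (Fin (n + 1))), o⟫ = (1 : ℝ) := by
    rw [real_inner_self_eq_norm_sq, norm_eq_of_mem_sphere, one_pow]
  have hv := L.orth v
  rw [real_inner_comm] at hv
  simp only [coe_sphExp, inner_add_left, inner_add_right, real_inner_smul_left,
    real_inner_smul_right, ho, hv, L.orth, L.toLin.inner_map_map, cosSide]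
  ring

theorem sphDist_sphExp {o : Sph n} (L : SphFrame o) {r : ℝ} (hr : r ∈ Icc 0 Real.pi)
    (v : sphere (0 : EuclideanSpace ℝ (Fin n)) 1) : sphDist o (sphExp L r v) = r := by
  have ho : ⟪(o : EuclideanSpace ℝ (Fin (n + 1))), o⟫ = (1 : ℝ) := by
    rw [real_inner_self_eq_norm_sq, norm_eq_of_mem_sphere, one_pow]
  rw [sphDist, InnerProductGeometry.angle, norm_eq_of_mem_sphere, norm_eq_of_mem_sphere, mul_one,
    div_one, coe_sphExp, inner_add_right, real_inner_smul_right, real_inner_smul_right, ho, L.orth,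
    mul_one, mul_zero, add_zero, Real.arccos_cos hr.1 hr.2]

/-- The coordinates `(t, y) ↦ t o + L y` preserve volume, being isometric. -/
theorem measurePreserving_sphFrame {o : Sph n} (L : SphFrame o) :
    MeasurePreserving (fun q : ℝ × EuclideanSpace ℝ (Fin n) =>
      q.1 • (o : EuclideanSpace ℝ (Fin (n + 1))) + L.toLin q.2) := by
  let A : WithLp 2 (ℝ × EuclideanSpace ℝ (Fin n)) →ₗ[ℝ] EuclideanSpace ℝ (Fin (n + 1)) :=
    { toFun := fun q => q.fst • (o : EuclideanSpace ℝ (Fin (n + 1))) + L.toLin q.snd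
      map_add' := fun q q' => by
        simp only [WithLp.add_fst, WithLp.add_snd, map_add]
        module
      map_smul' := fun c q => by
        simp only [WithLp.smul_fst, WithLp.smul_snd, map_smul, RingHom.id_apply, smul_eq_mul]
        module }
  have hA : ∀ q, ‖A q‖ = ‖q‖ := fun q => by
    have : ‖A q‖ ^ 2 = ‖q‖ ^ 2 := by
      rw [WithLp.prod_norm_sq_eq_of_L2]
      simp only [A, LinearMap.coe_mk, AddHom.coe_mk]
      rw [norm_add_sq_real, norm_smul, real_inner_smul_left, L.orth, L.toLin.norm_map,
        norm_eq_of_mem_sphere]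
      ring
    exact (sq_eq_sq₀ (norm_nonneg _) (norm_nonneg _)).1 this
  let T := (⟨A, hA⟩ : _ →ₗᵢ[ℝ] EuclideanSpace ℝ (Fin (n + 1))).toLinearIsometryEquiv (by
    rw [(WithLp.linearEquiv 2 ℝ (ℝ × EuclideanSpace ℝ (Fin n))).finrank_eq]
    simp [add_comm])
  exact T.measurePreserving.comp (WithLp.volume_preserving_toLp ℝ (EuclideanSpace ℝ (Fin n)))

/-- The volume of the sphere in geodesic polar coordinates. -/
theorem sphVolume_eq_map (hn : 1 ≤ n) {o : Sph n} (L : SphFrame o) :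
    sphVolume n = (polarMeasure Real.sin (Ioo 0 Real.pi) (EuclideanSpace ℝ (Fin n))).map
      (Function.uncurry (sphExp L)) := by
  have : Nonempty (Fin n) := ⟨⟨0, hn⟩⟩
  have hexp := (continuous_sphExp L).measurable
  refine Measure.ext fun s hs => ?_
  -- `U` is the truncated cone over `s`, which defines `sphVolume n s`.
  let H := homeomorphUnitSphereProd (EuclideanSpace ℝ (Fin (n + 1)))
  let U : Set (EuclideanSpace ℝ (Fin (n + 1))) := (↑) '' (H ⁻¹' s ×ˢ Iio ⟨1, mem_Ioi.2 one_pos⟩)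
  have hU : MeasurableSet U :=
    (MeasurableEmbedding.subtype_coe (measurableSet_singleton _).compl).measurableSet_image.2
      (H.measurable (hs.prod measurableSet_Iio))
  have hmem : ∀ R : ℝ, 0 < R → ∀ x : Sph n,
      R • (x : EuclideanSpace ℝ (Fin (n + 1))) ∈ U ↔ R < 1 ∧ x ∈ s := by
    intro R hR x
    have hx0 : R • (x : EuclideanSpace ℝ (Fin (n + 1))) ≠ 0 :=
      smul_ne_zero hR.ne' (ne_zero_of_mem_unit_sphere x)
    have hHx : H ⟨_, hx0⟩ = (x, ⟨R, hR⟩) := by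
      have hnorm : ‖R • (x : EuclideanSpace ℝ (Fin (n + 1)))‖ = R := by
        rw [norm_smul, norm_eq_of_mem_sphere, mul_one, Real.norm_of_nonneg hR.le]
      refine Prod.ext (Subtype.ext ?_) (Subtype.ext ?_)
      · rw [homeomorphUnitSphereProd_apply_fst_coe, hnorm, inv_smul_smul₀ hR.ne']
      · rw [homeomorphUnitSphereProd_apply_snd_coe, hnorm]
    constructor
    · rintro ⟨y, hy, hyx⟩
      have : y = ⟨_, hx0⟩ := Subtype.ext hyx
      rw [this, mem_preimage, hHx] at hy
      exact ⟨hy.2, hy.1⟩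
    · rintro ⟨h1, h2⟩
      exact ⟨⟨_, hx0⟩, by rw [mem_preimage, hHx]; exact ⟨h2, h1⟩, rfl⟩
  have h1 : sphVolume n s = ((n + 1 : ℕ) : ℝ≥0∞) * volume U := by
    rw [sphVolume, Measure.toSphere_apply' _ hs, finrank_euclideanSpace_fin]
    exact congrArg _ (Measure.toSphere_apply_aux volume s ⟨1, mem_Ioi.2 one_pos⟩).symm
  have h2 : volume U = ∫⁻ q : ℝ × EuclideanSpace ℝ (Fin n),
      U.indicator 1 (q.1 • (o : EuclideanSpace ℝ (Fin (n + 1))) + L.toLin q.2) := by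
    rw [(measurePreserving_sphFrame L).lintegral_comp (f := U.indicator 1)
      (measurable_one.indicator hU), lintegral_indicator_one hU]
  have h3 := isTrigPair_sphere.lintegral_cone (E := EuclideanSpace ℝ (Fin n))
    measurableSet_Ioo (fun r hr => Real.sin_pos_of_mem_Ioo hr) injOn_cot image_cot .univ
    ((measurable_one.indicator hU).comp (measurePreserving_sphFrame L).measurable)
  simp only [mem_univ, ofPred_true, Measure.restrict_univ, Function.comp_apply] at h3
  have h4 : ∀ q : ℝ × sphere (0 : EuclideanSpace ℝ (Fin n)) 1, ∀ R ∈ Ioi (0 : ℝ),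
      ENNReal.ofReal (R ^ Module.finrank ℝ (EuclideanSpace ℝ (Fin n))) *
        U.indicator 1 ((R * Real.cos q.1) • (o : EuclideanSpace ℝ (Fin (n + 1)))
          + L.toLin ((R * Real.sin q.1) • (q.2 : EuclideanSpace ℝ (Fin n))))
      = ENNReal.ofReal (R ^ n) * (if R < 1 then s.indicator 1 (sphExp L q.1 q.2) else 0) := by
    intro q R hR
    have : (R * Real.cos q.1) • (o : EuclideanSpace ℝ (Fin (n + 1)))
          + L.toLin ((R * Real.sin q.1) • (q.2 : EuclideanSpace ℝ (Fin n)))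
        = R • (sphExp L q.1 q.2 : EuclideanSpace ℝ (Fin (n + 1))) := by
      rw [coe_sphExp, map_smul]
      module
    rw [this, finrank_euclideanSpace_fin]
    congr 1
    by_cases h1 : R < 1 <;> by_cases h2 : sphExp L q.1 q.2 ∈ s <;>
      simp [indicator, hmem R hR, h1, h2]
  have h5 : ∀ q : ℝ × sphere (0 : EuclideanSpace ℝ (Fin n)) 1, _ := fun q =>
    (setLIntegral_congr_fun measurableSet_Ioi (h4 q)).trans
      (lintegral_Ioi_pow_mul_indicator n (s.indicator 1 (sphExp L q.1 q.2)))
  simp only [h5] at h3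
  have h6 : Measurable fun q : ℝ × sphere (0 : EuclideanSpace ℝ (Fin n)) 1 =>
      s.indicator (1 : Sph n → ℝ≥0∞) (sphExp L q.1 q.2) := (measurable_one.indicator hs).comp hexp
  rw [h1, h2, h3, lintegral_const_mul _ h6, ← mul_assoc,
    ENNReal.mul_inv_cancel (by simp) (ENNReal.natCast_ne_top _), one_mul,
    Measure.map_apply hexp hs, ← lintegral_indicator_one (hexp hs)]
  rfl

/-- Every point of the sphere is `sphExp L s e` with `s` its distance to `o`. -/
theorem exists_sphExp_eq (hn : 1 ≤ n) {o : Sph n} (L : SphFrame o) (p : Sph n) :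
    ∃ e, p = sphExp L (sphDist o p) e := by
  have : Nonempty (Fin n) := ⟨⟨0, hn⟩⟩
  have : Fact (Module.finrank ℝ (EuclideanSpace ℝ (Fin (n + 1))) = n + 1) := ⟨by simp⟩
  have hrange : LinearMap.range L.toLin.toLinearMap
      = (ℝ ∙ (o : EuclideanSpace ℝ (Fin (n + 1))))ᗮ := by
    refine Submodule.eq_of_le_of_finrank_eq ?_ ?_
    · rintro _ ⟨v, rfl⟩
      exact Submodule.mem_orthogonal_singleton_iff_inner_right.2 (L.orth v)
    · rw [LinearMap.finrank_range_of_inj L.toLin.injective, finrank_euclideanSpace_fin,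
        Submodule.finrank_orthogonal_span_singleton (n := n) (ne_zero_of_mem_unit_sphere o)]
  set s := sphDist o p with hs
  have ho : ⟪(o : EuclideanSpace ℝ (Fin (n + 1))), o⟫ = (1 : ℝ) := by
    rw [real_inner_self_eq_norm_sq, norm_eq_of_mem_sphere, one_pow]
  have hp : ⟪(p : EuclideanSpace ℝ (Fin (n + 1))), p⟫ = (1 : ℝ) := by
    rw [real_inner_self_eq_norm_sq, norm_eq_of_mem_sphere, one_pow]
  have hop : ⟪(o : EuclideanSpace ℝ (Fin (n + 1))), p⟫ = Real.cos s := by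
    rw [hs, sphDist, InnerProductGeometry.cos_angle, norm_eq_of_mem_sphere, norm_eq_of_mem_sphere,
      mul_one, div_one]
  have hw : (p : EuclideanSpace ℝ (Fin (n + 1))) - Real.cos s • (o : EuclideanSpace ℝ (Fin (n + 1)))
      ∈ LinearMap.range L.toLin.toLinearMap := by
    rw [hrange, Submodule.mem_orthogonal_singleton_iff_inner_right, inner_sub_right,
      real_inner_smul_right, ho, hop]
    ring
  obtain ⟨y, hy⟩ := hw
  replace hy : L.toLin y = p - Real.cos s • (o : EuclideanSpace ℝ (Fin (n + 1))) := hy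
  have hyn : ‖y‖ = Real.sin s := by
    have h0 : 0 ≤ Real.sin s := InnerProductGeometry.sin_angle_nonneg _ _
    rw [← sq_eq_sq₀ (norm_nonneg _) h0, ← L.toLin.norm_map, hy, ← real_inner_self_eq_norm_sq,
      Real.sin_sq]
    simp only [inner_sub_left, inner_sub_right, real_inner_smul_left, real_inner_smul_right, ho,
      hp, hop]
    rw [real_inner_comm, hop]
    ring
  obtain ⟨e, he⟩ := exists_eq_norm_smul_sphere y
  refine ⟨e, Subtype.ext ?_⟩
  rw [coe_sphExp, ← map_smul, ← hyn, ← he, hy]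
  module

theorem sphAttraction_sphExp (hn : 1 ≤ n) {o : Sph n} (L : SphFrame o) (G r s : ℝ)
    (v e : sphere (0 : EuclideanSpace ℝ (Fin n)) 1) :
    sphAttraction G (sphExp L s e) (sphExp L r v)
      = G • (invSinPow 1 Real.cos Real.sin (Module.finrank ℝ (EuclideanSpace ℝ (Fin n))) r s
          ⟪(v : EuclideanSpace ℝ (Fin n)), e⟫ •
        (Real.cos r • (o : EuclideanSpace ℝ (Fin (n + 1))) + Real.sin r • L.toLin v
          - cosSide 1 Real.cos Real.sin r s ⟪(v : EuclideanSpace ℝ (Fin n)), e⟫ •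
            (Real.cos s • (o : EuclideanSpace ℝ (Fin (n + 1))) + Real.sin s • L.toLin e))) := by
  have hcos : Real.cos (sphDist (sphExp L s e) (sphExp L r v))
      = cosSide 1 Real.cos Real.sin r s ⟪(v : EuclideanSpace ℝ (Fin n)), e⟫ := by
    rw [sphDist, InnerProductGeometry.cos_angle, norm_eq_of_mem_sphere, norm_eq_of_mem_sphere,
      real_inner_comm, inner_sphExp, mul_one, div_one]
  have hsin : Real.sin (sphDist (sphExp L s e) (sphExp L r v))
      = √(sinSqSide 1 Real.cos Real.sin r s ⟪(v : EuclideanSpace ℝ (Fin n)), e⟫) := by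
    rw [sinSqSide, one_mul, ← hcos, ← Real.abs_sin_eq_sqrt_one_sub_cos_sq, abs_of_nonneg]
    exact InnerProductGeometry.sin_angle_nonneg _ _
  obtain ⟨m, rfl⟩ : ∃ m, n = m + 1 := ⟨_, (Nat.succ_pred_eq_of_pos hn).symm⟩
  rw [sphAttraction, sphDir, hcos, hsin, smul_smul, smul_smul, invSinPow,
    finrank_euclideanSpace_fin, Nat.add_sub_cancel, coe_sphExp, coe_sphExp]
  congr 1
  rw [pow_succ, mul_inv, div_eq_mul_inv, mul_assoc]

theorem sinSqSide_sphere_pos {r s u : ℝ} (h1 : 0 < |r - s|) (h2 : |r - s| < Real.pi)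
    (h3 : 0 < r + s) (h4 : r + s < Real.pi) (hu : u ∈ Icc (-1 : ℝ) 1) :
    0 < sinSqSide 1 Real.cos Real.sin r s u := by
  have hlt : ∀ x, 0 < x → x < Real.pi → Real.cos x < 1 ∧ -1 < Real.cos x := fun x h0 h1 => by
    constructor
    · rw [← Real.cos_zero]
      exact Real.cos_lt_cos_of_nonneg_of_le_pi le_rfl h1.le h0
    · rw [← Real.cos_pi]
      exact Real.cos_lt_cos_of_nonneg_of_le_pi h0.le le_rfl h1
  obtain ⟨a1, a2⟩ := hlt _ h1 h2
  obtain ⟨b1, b2⟩ := hlt _ h3 h4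
  rw [Real.cos_abs] at a1 a2
  have hc : cosSide 1 Real.cos Real.sin r s u
      = (1 + u) / 2 * Real.cos (r - s) + (1 - u) / 2 * Real.cos (r + s) := by
    rw [cosSide, Real.cos_sub, Real.cos_add]
    ring
  have hm : ((1 + u) / 2) • Real.cos (r - s) + ((1 - u) / 2) • Real.cos (r + s)
      ∈ Ioo (-1 : ℝ) 1 :=
    convex_Ioo (-1 : ℝ) 1 ⟨a2, a1⟩ ⟨b2, b1⟩ (by linarith [hu.1]) (by linarith [hu.2]) (by ring)
  simp only [smul_eq_mul] at hm
  rw [← hc] at hm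
  obtain ⟨c1, c2⟩ := hm
  rw [sinSqSide]
  nlinarith

end Sphere

/-! ### The hyperbolic space -/

section Hyperbolic

variable {n : ℕ}

theorem injOn_coth : InjOn (fun r => Real.cosh r / Real.sinh r) (Ioi 0) := by
  intro r hr s hs hrs
  have h1 := Real.sinh_pos_iff.2 hr
  have h2 := Real.sinh_pos_iff.2 hs
  have h3 : Real.sinh (r - s) = 0 := by
    rw [div_eq_div_iff h1.ne' h2.ne'] at hrs
    rw [Real.sinh_sub]
    linarith
  linarith [Real.sinh_eq_zero.1 h3]

theorem image_coth : (fun r => Real.cosh r / Real.sinh r) '' Ioi 0 = Ioi 1 := by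
  ext t
  constructor
  · rintro ⟨r, hr, rfl⟩
    have h1 := Real.sinh_pos_iff.2 hr
    exact (one_lt_div h1).2 (Real.sinh_lt_cosh r)
  · intro ht
    have ht : 1 < t := ht
    have ht2 : 0 < t ^ 2 - 1 := by nlinarith
    have hq : 0 < √(t ^ 2 - 1) := Real.sqrt_pos.2 ht2
    refine ⟨Real.arsinh (1 / √(t ^ 2 - 1)), Real.arsinh_pos_iff.2 (by positivity), ?_⟩
    have h1 : 1 + (1 / √(t ^ 2 - 1)) ^ 2 = (t / √(t ^ 2 - 1)) ^ 2 := by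
      rw [div_pow, div_pow, Real.sq_sqrt ht2.le]
      field_simp
      ring
    simp only
    rw [Real.cosh_arsinh, Real.sinh_arsinh, h1, Real.sqrt_sq (by positivity)]
    field_simp

theorem mink_add_smul_left (a b : ℝ) (x y z : ℝ × EuclideanSpace ℝ (Fin n)) :
    mink (a • x + b • y) z = a * mink x z + b * mink y z := by
  simp only [mink, Prod.fst_add, Prod.snd_add, Prod.smul_fst, Prod.smul_snd, smul_eq_mul,
    inner_add_left, real_inner_smul_left]
  ring

theorem mink_comm (x y : ℝ × EuclideanSpace ℝ (Fin n)) : mink x y = mink y x := by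
  rw [mink, mink, mul_comm, real_inner_comm]

theorem mink_add_smul_right (a b : ℝ) (x y z : ℝ × EuclideanSpace ℝ (Fin n)) :
    mink x (a • y + b • z) = a * mink x y + b * mink x z := by
  rw [mink_comm, mink_add_smul_left, mink_comm y, mink_comm z]

theorem continuous_mink : Continuous fun q : (ℝ × EuclideanSpace ℝ (Fin n))
    × (ℝ × EuclideanSpace ℝ (Fin n)) => mink q.1 q.2 := by
  unfold mink
  fun_prop

/-- A point of hyperbolic space is determined by its image in the chart `hypChart`. -/
theorem Hyp.eq_hypChart (x : Hyp n) : x = hypChart x.1.2 := by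
  obtain ⟨⟨t, y⟩, ht, h⟩ := x
  refine Subtype.ext (Prod.ext ?_ rfl)
  simp only [mink, real_inner_self_eq_norm_sq] at h ht
  simp only [hypChart]
  rw [show 1 + ‖y‖ ^ 2 = t ^ 2 by linarith, Real.sqrt_sq ht.le]

theorem continuous_hypChart : Continuous (hypChart (n := n)) := by
  unfold hypChart
  refine Continuous.subtype_mk ?_ _
  fun_prop

theorem coe_hypExp {o : Hyp n} (L : HypFrame o) (r : ℝ)
    (v : sphere (0 : EuclideanSpace ℝ (Fin n)) 1) :
    (hypExp L r v : ℝ × EuclideanSpace ℝ (Fin n)) = Real.cosh r • o.1 + Real.sinh r • L.toLin v :=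
  rfl

theorem continuous_hypExp {o : Hyp n} (L : HypFrame o) :
    Continuous (Function.uncurry (hypExp L)) := by
  have := L.toLin.continuous_of_finiteDimensional
  refine Continuous.subtype_mk ?_ _
  fun_prop

theorem mink_hypExp {o : Hyp n} (L : HypFrame o) (r s : ℝ)
    (v e : sphere (0 : EuclideanSpace ℝ (Fin n)) 1) :
    mink (hypExp L r v).1 (hypExp L s e).1
      = -cosSide (-1) Real.cosh Real.sinh r s ⟪(v : EuclideanSpace ℝ (Fin n)), e⟫ := by
  have hv := L.orth v
  rw [mink_comm] at hv
  simp only [coe_hypExp, mink_add_smul_left, mink_add_smul_right, o.2.2, hv, L.orth, L.isom,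
    cosSide]
  ring

theorem hypDist_hypExp {o : Hyp n} (L : HypFrame o) {r : ℝ} (hr : 0 ≤ r)
    (v : sphere (0 : EuclideanSpace ℝ (Fin n)) 1) : hypDist o (hypExp L r v) = r := by
  rw [hypDist, coe_hypExp, mink_add_smul_right, o.2.2, L.orth]
  simp [Real.arcosh_cosh hr]

/-- The linear map `(t, y) ↦ t o + L y`, a Lorentz transformation. -/
def HypFrame.toLorentz {o : Hyp n} (L : HypFrame o) :
    ℝ × EuclideanSpace ℝ (Fin n) →ₗ[ℝ] ℝ × EuclideanSpace ℝ (Fin n) :=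
  (LinearMap.toSpanSingleton ℝ _ o.1).coprod L.toLin

theorem HypFrame.toLorentz_apply {o : Hyp n} (L : HypFrame o)
    (q : ℝ × EuclideanSpace ℝ (Fin n)) : L.toLorentz q = q.1 • o.1 + (1 : ℝ) • L.toLin q.2 := by
  simp [toLorentz]

theorem HypFrame.mink_toLorentz {o : Hyp n} (L : HypFrame o)
    (q q' : ℝ × EuclideanSpace ℝ (Fin n)) : mink (L.toLorentz q) (L.toLorentz q') = mink q q' := by
  have hv := L.orth q.2
  rw [mink_comm] at hv
  simp only [L.toLorentz_apply, mink_add_smul_left, mink_add_smul_right, o.2.2, hv, L.orth, L.isom]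
  rw [mink]
  ring

/-- The Minkowski scalar product as a bilinear form. -/
def minkForm (n : ℕ) : LinearMap.BilinForm ℝ (ℝ × EuclideanSpace ℝ (Fin n)) :=
  LinearMap.mk₂ ℝ mink
    (fun x y z => by simpa using mink_add_smul_left 1 1 x y z)
    (fun c x y => by simpa using mink_add_smul_left c 0 x 0 y)
    (fun x y z => by simpa using mink_add_smul_right 1 1 x y z)
    (fun c x y => by simpa using mink_add_smul_right c 0 x y 0)

theorem minkForm_nondegenerate : (minkForm n).Nondegenerate := by
  have hl : ∀ x : ℝ × EuclideanSpace ℝ (Fin n), (∀ y, mink x y = 0) → x = 0 := fun x hx => by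
    have h := hx (-x.1, x.2)
    simp only [mink, real_inner_self_eq_norm_sq] at h
    have h1 : x.1 = 0 := by nlinarith [sq_nonneg x.1, sq_nonneg ‖x.2‖]
    have h2 : ‖x.2‖ = 0 := by nlinarith [sq_nonneg x.1, sq_nonneg ‖x.2‖]
    exact Prod.ext h1 (norm_eq_zero.1 h2)
  exact ⟨hl, fun y hy => hl y fun x => (mink_comm y x).trans (hy x)⟩

/-- Comparing determinants of Gram matrices: `(det T) ^ 2 = 1`, since `T` preserves the
nondegenerate form `minkForm n`. -/
theorem HypFrame.abs_det_toLorentz {o : Hyp n} (L : HypFrame o) :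
    |LinearMap.det L.toLorentz| = 1 := by
  let b := Module.finBasis ℝ (ℝ × EuclideanSpace ℝ (Fin n))
  have h1 : (minkForm n).comp L.toLorentz L.toLorentz = minkForm n :=
    LinearMap.ext₂ fun x y => L.mink_toLorentz x y
  have h2 := LinearMap.BilinForm.toMatrix_comp (b := b) (c := b) (minkForm n)
    L.toLorentz L.toLorentz
  rw [h1] at h2
  have h3 := congrArg Matrix.det h2
  rw [Matrix.det_mul, Matrix.det_mul, Matrix.det_transpose, LinearMap.det_toMatrix] at h3
  have h4 := (LinearMap.BilinForm.nondegenerate_iff_det_ne_zero b).1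
    (minkForm_nondegenerate (n := n))
  have h5 : LinearMap.det L.toLorentz ^ 2 = 1 := by
    apply mul_left_cancel₀ h4
    linarith
  rw [← sq_abs] at h5
  exact (sq_eq_sq₀ (abs_nonneg _) zero_le_one).1 (by rw [h5, one_pow])

theorem HypFrame.measurePreserving_toLorentz {o : Hyp n} (L : HypFrame o) :
    MeasurePreserving L.toLorentz := by
  have h := L.abs_det_toLorentz
  have h0 : LinearMap.det L.toLorentz ≠ 0 := fun h0 => by simp [h0] at h
  have : (volume : Measure (ℝ × EuclideanSpace ℝ (Fin n))).IsAddHaarMeasure :=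
    Measure.prod.instIsAddHaarMeasure _ _
  refine ⟨L.toLorentz.continuous_of_finiteDimensional.measurable, ?_⟩
  rw [Measure.map_linearMap_addHaar_eq_smul_addHaar _ h0, abs_inv, h]
  simp

/-- The time coordinate of `t o + L y` is positive if `t > |y|`. -/
theorem HypFrame.toLorentz_fst_pos {o : Hyp n} (L : HypFrame o) {t : ℝ}
    {y : EuclideanSpace ℝ (Fin n)} (h : ‖y‖ < t) : 0 < (L.toLorentz (t, y)).1 := by
  obtain ⟨ho, hoo⟩ := o.2
  have h1 := L.orth y
  have h2 := L.isom y y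
  have hc := real_inner_mul_inner_self_le o.1.2 (L.toLin y).2
  rw [L.toLorentz_apply]
  simp only [mink, real_inner_self_eq_norm_sq, Prod.fst_add, Prod.smul_fst, smul_eq_mul] at *
  generalize (L.toLin y).1 = l at *
  generalize ⟪o.1.2, (L.toLin y).2⟫ = i at *
  generalize ‖(L.toLin y).2‖ = w at *
  generalize ‖o.1.2‖ = z at *
  generalize o.1.1 = a at *
  have hi : i = a * l := by linarith
  have hy := norm_nonneg y
  have h3 : l ^ 2 ≤ (a ^ 2 - 1) * ‖y‖ ^ 2 := by
    subst hi
    have : z ^ 2 = a ^ 2 - 1 := by linarith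
    have : w ^ 2 = ‖y‖ ^ 2 + l ^ 2 := by linarith
    nlinarith
  have h4 : |l| < a * t := by
    apply abs_lt_of_sq_lt_sq _ (by nlinarith)
    have h5 : ‖y‖ ^ 2 < t ^ 2 := by nlinarith
    have h6 := mul_lt_mul_of_pos_left h5 (pow_pos ho 2)
    nlinarith [sq_nonneg ‖y‖]
  linarith [(abs_lt.1 h4).1]

/-- Up to the factor `n + 1`, the integral of `F` in the geodesic polar coordinates given by any
frame is the integral of the homogeneous extension of `F` over the truncated future cone, hence it
does not depend on the frame. -/
theorem lintegral_hypExp_eq_cone (hn : 1 ≤ n) {o : Hyp n} (L : HypFrame o) {F : Hyp n → ℝ≥0∞}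
    (hF : Measurable F) :
    ((n + 1 : ℕ) : ℝ≥0∞)⁻¹ * ∫⁻ q, F (Function.uncurry (hypExp L) q)
        ∂polarMeasure Real.sinh (Ioi 0) (EuclideanSpace ℝ (Fin n))
      = ∫⁻ x in {x : ℝ × EuclideanSpace ℝ (Fin n) | 0 < x.1 ∧ mink x x < 0},
        (if √(-mink x x) < 1 then F (hypChart ((√(-mink x x))⁻¹ • x.2)) else 0) := by
  have : Nonempty (Fin n) := ⟨⟨0, hn⟩⟩
  have hmk : Continuous fun x : ℝ × EuclideanSpace ℝ (Fin n) => mink x x :=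
    continuous_mink.comp (f := fun x => (x, x)) (by fun_prop)
  have hK : MeasurableSet {x : ℝ × EuclideanSpace ℝ (Fin n) | 0 < x.1 ∧ mink x x < 0} :=
    (measurableSet_lt measurable_const measurable_fst).inter
      (measurableSet_lt hmk.measurable measurable_const)
  have hh : Measurable fun x : ℝ × EuclideanSpace ℝ (Fin n) =>
      if √(-mink x x) < 1 then F (hypChart ((√(-mink x x))⁻¹ • x.2)) else 0 := by
    have hmm := hmk.measurable
    have hch := continuous_hypChart (n := n).measurable
    exact Measurable.ite (measurableSet_lt (by fun_prop) measurable_const) (by fun_prop)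
      measurable_const
  have hae : (L.toLorentz ⁻¹' {x | 0 < x.1 ∧ mink x x < 0} : Set _)
      =ᵐ[volume] {q : ℝ × EuclideanSpace ℝ (Fin n) | q.1 / ‖q.2‖ ∈ Ioi 1} := by
    have h0 : ∀ᵐ y : EuclideanSpace ℝ (Fin n), y ≠ 0 := Measure.ae_ne volume 0
    filter_upwards [Measure.quasiMeasurePreserving_snd.ae h0] with q hq
    have hq0 : 0 < ‖q.2‖ := norm_pos_iff.2 hq
    refine propext (Iff.trans ?_ (one_lt_div hq0).symm)
    change (0 < (L.toLorentz q).1 ∧ mink (L.toLorentz q) (L.toLorentz q) < 0) ↔ _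
    rw [L.mink_toLorentz, mink, real_inner_self_eq_norm_sq]
    constructor
    · rintro ⟨h1, h2⟩
      by_contra! h3
      have h4 : ‖(-q).2‖ < (-q).1 := by
        rw [Prod.snd_neg, norm_neg, Prod.fst_neg]
        by_contra! h5
        nlinarith
      have h6 := L.toLorentz_fst_pos h4
      rw [Prod.mk.eta, map_neg, Prod.fst_neg] at h6
      linarith
    · intro h1
      exact ⟨L.toLorentz_fst_pos h1, by nlinarith⟩
  have key := isTrigPair_hyperbolic.lintegral_cone (E := EuclideanSpace ℝ (Fin n))
    measurableSet_Ioi (fun r hr => Real.sinh_pos_iff.2 hr) injOn_coth image_coth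
    measurableSet_Ioi (hh.comp L.measurePreserving_toLorentz.measurable)
  simp only [Function.comp_def] at key
  have hFe : Measurable fun q => F (Function.uncurry (hypExp L) q) :=
    hF.comp (continuous_hypExp L).measurable
  rw [← L.measurePreserving_toLorentz.setLIntegral_comp_preimage hK hh,
    setLIntegral_congr hae, key,
    ← lintegral_const_mul _ hFe]
  refine lintegral_congr fun q => ?_
  rw [← lintegral_Ioi_pow_mul_indicator]
  refine setLIntegral_congr_fun measurableSet_Ioi fun R hR => ?_
  have hR : 0 < R := hR
  have h1 : L.toLorentz (R * Real.cosh q.1, (R * Real.sinh q.1) • (q.2 : EuclideanSpace ℝ (Fin n)))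
      = R • (hypExp L q.1 q.2).1 + (0 : ℝ) • 0 := by
    rw [coe_hypExp, L.toLorentz_apply, map_smul]
    module
  have h2 : √(-mink (R • (hypExp L q.1 q.2).1 + (0 : ℝ) • 0)
      (R • (hypExp L q.1 q.2).1 + (0 : ℝ) • 0)) = R := by
    have h3 : mink (0 : ℝ × EuclideanSpace ℝ (Fin n)) = 0 := by
      ext
      simp [mink]
    rw [← Real.sqrt_sq hR.le]
    congr 1
    rw [mink_add_smul_left, mink_add_smul_right, (hypExp L q.1 q.2).2.2, h3]
    simp [Real.sqrt_sq hR.le]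
    ring
  rw [finrank_euclideanSpace_fin, h1, h2, zero_smul, add_zero, Prod.smul_snd,
    inv_smul_smul₀ hR.ne', ← Hyp.eq_hypChart]
  rfl

/-- The standard base point of hyperbolic space. -/
def hypOrigin (n : ℕ) : Hyp n := ⟨(1, 0), by simp [mink]⟩

/-- The standard frame at the standard base point. -/
def hypOriginFrame (n : ℕ) : HypFrame (hypOrigin n) where
  toLin := LinearMap.inr ℝ ℝ _
  isom v w := by simp [mink]
  orth v := by simp [mink, hypOrigin]

theorem image_sinh_Ioi : Real.sinh '' Ioi 0 = Ioi 0 := by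
  ext x
  constructor
  · rintro ⟨r, hr, rfl⟩
    exact Real.sinh_pos_iff.2 hr
  · intro hx
    exact ⟨Real.arsinh x, Real.arsinh_pos_iff.2 hx, Real.sinh_arsinh x⟩

/-- Polar coordinates in the chart `hypChart`, with `ρ = sinh r`. -/
theorem lintegral_hypVolume (hn : 1 ≤ n) {F : Hyp n → ℝ≥0∞} (hF : Measurable F) :
    ∫⁻ x, F x ∂hypVolume n = ∫⁻ q, F (Function.uncurry (hypExp (hypOriginFrame n)) q)
        ∂polarMeasure Real.sinh (Ioi 0) (EuclideanSpace ℝ (Fin n)) := by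
  have : Nonempty (Fin n) := ⟨⟨0, hn⟩⟩
  have hch := continuous_hypChart (n := n).measurable
  have hFe : Measurable fun q => F (Function.uncurry (hypExp (hypOriginFrame n)) q) :=
    hF.comp (continuous_hypExp (hypOriginFrame n)).measurable
  have hFc : Measurable fun x => F (hypChart (n := n) x) := hF.comp hch
  rw [hypVolume, lintegral_map hF hch, lintegral_withDensity_eq_lintegral_mul _ (by fun_prop) hFc,
    lintegral_polar (by fun_prop),
    lintegral_polarMeasure Real.continuous_sinh hFe]
  simp only [finrank_euclideanSpace_fin, Pi.mul_apply]
  have h1 : ∀ v : sphere (0 : EuclideanSpace ℝ (Fin n)) 1, ∫⁻ ρ in Ioi (0 : ℝ),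
      ENNReal.ofReal (ρ ^ (n - 1))
        * (ENNReal.ofReal (1 / √(1 + ‖ρ • (v : EuclideanSpace ℝ (Fin n))‖ ^ 2))
        * F (hypChart (ρ • (v : EuclideanSpace ℝ (Fin n)))))
      = ∫⁻ r in Ioi (0 : ℝ), ENNReal.ofReal (Real.sinh r ^ (n - 1))
        * F (Function.uncurry (hypExp (hypOriginFrame n)) (r, v)) := by
    intro v
    conv_lhs => rw [← image_sinh_Ioi]
    rw [lintegral_image_eq_lintegral_abs_deriv_mul measurableSet_Ioi
      (fun r _ => (Real.hasDerivAt_sinh r).hasDerivWithinAt) Real.sinh_injective.injOn]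
    refine setLIntegral_congr_fun measurableSet_Ioi fun r hr => ?_
    have hc := Real.cosh_pos r
    have hs := Real.sinh_pos_iff.2 hr
    have h2 : hypChart (Real.sinh r • (v : EuclideanSpace ℝ (Fin n)))
        = hypExp (hypOriginFrame n) r v := by
      rw [Hyp.eq_hypChart (hypExp (hypOriginFrame n) r v), coe_hypExp]
      congr 1
      simp [hypOriginFrame, hypOrigin]
    have h3 : √(1 + ‖Real.sinh r • (v : EuclideanSpace ℝ (Fin n))‖ ^ 2) = Real.cosh r := by
      rw [norm_smul, norm_eq_of_mem_sphere, mul_one, Real.norm_eq_abs, sq_abs, add_comm,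
        ← Real.cosh_sq, Real.sqrt_sq hc.le]
    rw [h2, h3, abs_of_pos hc, ← mul_assoc, ← mul_assoc, mul_comm (ENNReal.ofReal (Real.cosh r)),
      mul_assoc (ENNReal.ofReal _), ← ENNReal.ofReal_mul hc.le, mul_one_div_cancel hc.ne',
      ENNReal.ofReal_one, mul_one]
    rfl
  have hdens : Measurable fun q : sphere (0 : EuclideanSpace ℝ (Fin n)) 1 × ℝ =>
      ENNReal.ofReal (Real.sinh q.2 ^ (n - 1)) := by fun_prop
  simp only [h1]
  rw [lintegral_lintegral_swap (hdens.mul (hFe.comp measurable_swap)).aemeasurable]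
  refine lintegral_congr fun r => ?_
  exact lintegral_const_mul _ (hFe.comp measurable_prodMk_left)

/-- The volume of hyperbolic space in geodesic polar coordinates. -/
theorem hypVolume_eq_map (hn : 1 ≤ n) {o : Hyp n} (L : HypFrame o) :
    hypVolume n = (polarMeasure Real.sinh (Ioi 0) (EuclideanSpace ℝ (Fin n))).map
      (Function.uncurry (hypExp L)) := by
  refine Measure.ext_of_lintegral _ fun F hF => ?_
  have h1 := lintegral_hypExp_eq_cone hn L hF
  rw [← lintegral_hypExp_eq_cone hn (hypOriginFrame n) hF] at h1
  rw [lintegral_map hF (continuous_hypExp L).measurable, lintegral_hypVolume hn hF]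
  exact ((ENNReal.mul_right_inj (by simp) (by simp)).1 h1).symm

/-- The reversed Cauchy–Schwarz inequality. -/
theorem one_le_neg_mink (x y : Hyp n) : 1 ≤ -mink x.1 y.1 := by
  obtain ⟨ht, hx⟩ := x.2
  obtain ⟨hs, hy⟩ := y.2
  have hi := real_inner_mul_inner_self_le x.1.2 y.1.2
  simp only [mink, real_inner_self_eq_norm_sq] at hx hy hi ⊢
  have h1 : ‖x.1.2‖ ^ 2 = x.1.1 ^ 2 - 1 := by linarith
  have h2 : ‖y.1.2‖ ^ 2 = y.1.1 ^ 2 - 1 := by linarith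
  have ht1 : 1 ≤ x.1.1 := by nlinarith [sq_nonneg ‖x.1.2‖]
  have hs1 : 1 ≤ y.1.1 := by nlinarith [sq_nonneg ‖y.1.2‖]
  rw [h1, h2] at hi
  have h3 : ⟪x.1.2, y.1.2⟫ ≤ x.1.1 * y.1.1 - 1 := by
    apply le_of_sq_le_sq _ (by nlinarith)
    nlinarith [sq_nonneg (x.1.1 - y.1.1)]
  linarith

theorem hypDist_nonneg (o p : Hyp n) : 0 ≤ hypDist o p :=
  Real.arcosh_nonneg (one_le_neg_mink o p)

theorem cosh_hypDist (o p : Hyp n) : Real.cosh (hypDist o p) = -mink o.1 p.1 :=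
  Real.cosh_arcosh (one_le_neg_mink o p)

/-- Every point of hyperbolic space is `hypExp L s e` with `s` its distance to `o`. -/
theorem exists_hypExp_eq (hn : 1 ≤ n) {o : Hyp n} (L : HypFrame o) (p : Hyp n) :
    ∃ e, p = hypExp L (hypDist o p) e := by
  have : Nonempty (Fin n) := ⟨⟨0, hn⟩⟩
  have h0 : LinearMap.det L.toLorentz ≠ 0 := fun h0 => by
    simpa [h0] using L.abs_det_toLorentz
  obtain ⟨⟨t, y⟩, hq⟩ := (L.toLorentz.equivOfDetNeZero h0).surjective p.1
  replace hq : L.toLorentz (t, y) = p.1 := hq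
  have h1 := L.mink_toLorentz (t, y) (t, y)
  rw [hq, p.2.2, mink, real_inner_self_eq_norm_sq] at h1
  have hc := cosh_hypDist o p
  rw [← hq, L.toLorentz_apply, mink_add_smul_right, o.2.2, L.orth] at hc
  have hs0 := Real.sinh_nonneg_iff.2 (hypDist_nonneg o p)
  have ht : t = Real.cosh (hypDist o p) := by linarith
  have hy : ‖y‖ = Real.sinh (hypDist o p) := by
    rw [← sq_eq_sq₀ (norm_nonneg _) hs0, Real.sinh_sq, ← ht]
    linarith
  obtain ⟨e, he⟩ := exists_eq_norm_smul_sphere y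
  refine ⟨e, Subtype.ext ?_⟩
  rw [coe_hypExp, ← ht, ← hy, ← map_smul, ← he, ← hq, L.toLorentz_apply, one_smul]

theorem hypAttraction_hypExp (hn : 1 ≤ n) {o : Hyp n} (L : HypFrame o) (G r s : ℝ)
    (v e : sphere (0 : EuclideanSpace ℝ (Fin n)) 1) :
    hypAttraction G (hypExp L s e) (hypExp L r v)
      = G • (invSinPow (-1) Real.cosh Real.sinh (Module.finrank ℝ (EuclideanSpace ℝ (Fin n))) r s
          ⟪(v : EuclideanSpace ℝ (Fin n)), e⟫ •
        (Real.cosh r • o.1 + Real.sinh r • L.toLin v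
          - cosSide (-1) Real.cosh Real.sinh r s ⟪(v : EuclideanSpace ℝ (Fin n)), e⟫ •
            (Real.cosh s • o.1 + Real.sinh s • L.toLin e))) := by
  have hcos : Real.cosh (hypDist (hypExp L s e) (hypExp L r v))
      = cosSide (-1) Real.cosh Real.sinh r s ⟪(v : EuclideanSpace ℝ (Fin n)), e⟫ := by
    rw [cosh_hypDist, mink_comm, mink_hypExp, neg_neg]
  have hsin : Real.sinh (hypDist (hypExp L s e) (hypExp L r v))
      = √(sinSqSide (-1) Real.cosh Real.sinh r s ⟪(v : EuclideanSpace ℝ (Fin n)), e⟫) := by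
    rw [sinSqSide, ← hcos, ← Real.sqrt_sq (Real.sinh_nonneg_iff.2 (hypDist_nonneg _ _)),
      Real.sinh_sq]
    congr 1
    ring
  obtain ⟨m, rfl⟩ : ∃ m, n = m + 1 := ⟨_, (Nat.succ_pred_eq_of_pos hn).symm⟩
  rw [hypAttraction, hypDir, hcos, hsin, smul_smul, smul_smul, invSinPow,
    finrank_euclideanSpace_fin, Nat.add_sub_cancel, coe_hypExp, coe_hypExp]
  congr 1
  rw [pow_succ, mul_inv, div_eq_mul_inv, mul_assoc]

theorem sinSqSide_hyperbolic_pos {r s u : ℝ} (h1 : r ≠ s) (h2 : 0 < r + s)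
    (hu : u ∈ Icc (-1 : ℝ) 1) : 0 < sinSqSide (-1) Real.cosh Real.sinh r s u := by
  have a1 := Real.one_lt_cosh.2 (sub_ne_zero.2 h1)
  have b1 := Real.one_lt_cosh.2 h2.ne'
  have hc : cosSide (-1) Real.cosh Real.sinh r s u
      = (1 + u) / 2 * Real.cosh (r - s) + (1 - u) / 2 * Real.cosh (r + s) := by
    rw [cosSide, Real.cosh_sub, Real.cosh_add]
    ring
  have hm : ((1 + u) / 2) • Real.cosh (r - s) + ((1 - u) / 2) • Real.cosh (r + s)
      ∈ Ioi (1 : ℝ) :=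
    convex_Ioi (1 : ℝ) a1 b1 (by linarith [hu.1]) (by linarith [hu.2]) (by ring)
  simp only [smul_eq_mul] at hm
  rw [← hc] at hm
  have hm : 1 < cosSide (-1) Real.cosh Real.sinh r s u := hm
  rw [sinSqSide]
  nlinarith

end Hyperbolic

/-! ### Shells -/

section Shells

variable {E : Type*} [NormedAddCommGroup E] [InnerProductSpace ℝ E] [FiniteDimensional ℝ E]
  [MeasurableSpace E] [BorelSpace E] {X : Type*} [MeasurableSpace X]

/-- A mass distribution on `X` obtained by spreading the finite mass distribution `ν` of the radii,
carried by `[a, b]`, uniformly over the spheres with center `o`; here `Φ (r, v)` is the point at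
distance `r` from `o` in the direction `v`. -/
def IsRadialShell (Φ : ℝ × sphere (0 : E) 1 → X) (a b : ℝ) (μ : Measure X) : Prop :=
  ∃ ν : Measure ℝ, IsFiniteMeasure ν ∧ ν (Icc a b)ᶜ = 0 ∧
    μ = (ν.prod (volume : Measure E).toSphere).map Φ

theorem IsRadialShell.smul {Φ : ℝ × sphere (0 : E) 1 → X} {a b : ℝ} {μ : Measure X}
    (h : IsRadialShell Φ a b μ) (ρ : ℝ≥0) : IsRadialShell Φ a b (ρ • μ) := by
  obtain ⟨ν, hν, hab, rfl⟩ := h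
  refine ⟨ρ • ν, inferInstance, by simp [hab], ?_⟩
  rw [← Measure.map_smul]
  congr 1
  exact (Measure.prod_smul_left (ρ : ℝ≥0∞)).symm

theorem isRadialShell_thin {Φ : ℝ → sphere (0 : E) 1 → X} (hΦ : Measurable (Function.uncurry Φ))
    (a c : ℝ) : IsRadialShell (Function.uncurry Φ) a a
      (ENNReal.ofReal c • (volume : Measure E).toSphere.map (Φ a)) := by
  refine IsRadialShell.smul (ρ := c.toNNReal) ⟨Measure.dirac a, inferInstance, by simp, ?_⟩
  rw [Measure.dirac_prod, Measure.map_map hΦ (by fun_prop)]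
  rfl

theorem isRadialShell_thick {S : ℝ → ℝ} (hS : Continuous S) {J : Set ℝ} (hJ : MeasurableSet J)
    {Φ : ℝ × sphere (0 : E) 1 → X} (hΦ : Measurable Φ) {d : X → ℝ} (hd : Measurable d)
    (hdΦ : ∀ r ∈ J, ∀ v, d (Φ (r, v)) = r) (a b : ℝ) :
    IsRadialShell Φ a b (((polarMeasure S J E).map Φ).restrict {x | a ≤ d x ∧ d x ≤ b}) := by
  set f : ℝ → ℝ≥0∞ := fun r => ENNReal.ofReal (S r ^ (Module.finrank ℝ E - 1)) with hf
  have hs : MeasurableSet {x | a ≤ d x ∧ d x ≤ b} := hd measurableSet_Icc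
  refine ⟨((volume.restrict J).withDensity f).restrict (Icc a b), ⟨?_⟩, ?_, ?_⟩
  · rw [Measure.restrict_apply_univ, withDensity_apply _ measurableSet_Icc]
    have h1 : IntegrableOn (fun r => S r ^ (Module.finrank ℝ E - 1)) (Icc a b) :=
      (hS.pow _).continuousOn.integrableOn_compact isCompact_Icc
    refine lt_of_le_of_lt (lintegral_mono'
      (Measure.restrict_mono_measure Measure.restrict_le_self _) le_rfl) ?_
    exact Integrable.lintegral_lt_top h1
  · rw [Measure.restrict_apply measurableSet_Icc.compl, compl_inter_self, measure_empty]
  · rw [Measure.restrict_map hΦ hs]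
    congr 1
    have hJae : ∀ᵐ q ∂polarMeasure S J E, q.1 ∈ J :=
      Measure.quasiMeasurePreserving_fst.ae
        ((withDensity_absolutelyContinuous _ f).ae_le (ae_restrict_mem hJ))
    have hset : (Φ ⁻¹' {x | a ≤ d x ∧ d x ≤ b} : Set _) =ᵐ[polarMeasure S J E]
        (Icc a b ×ˢ univ : Set (ℝ × sphere (0 : E) 1)) := by
      filter_upwards [hJae] with q hq
      refine propext ?_
      change (a ≤ d (Φ (q.1, q.2)) ∧ d (Φ (q.1, q.2)) ≤ b) ↔ q ∈ Icc a b ×ˢ univ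
      rw [hdΦ _ hq]
      simp
    rw [Measure.restrict_congr_set hset, polarMeasure, ← Measure.prod_restrict,
      Measure.restrict_univ]

theorem IsRadialShell.isFiniteMeasure {Φ : ℝ × sphere (0 : E) 1 → X} {a b : ℝ} {μ : Measure X}
    (h : IsRadialShell Φ a b μ) : IsFiniteMeasure μ := by
  obtain ⟨ν, hν, hab, rfl⟩ := h
  infer_instance

/-- If every geodesic sphere of the shell, with the measure `σ`, attracts with the same force
`σ(univ) K`, then the attraction of the shell is its mass times `K`. -/
theorem IsRadialShell.integral_eq {V : Type*} [NormedAddCommGroup V] [NormedSpace ℝ V]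
    [SecondCountableTopology V] [MeasurableSpace V] [BorelSpace V] [CompleteSpace V]
    {Φ : ℝ × sphere (0 : E) 1 → X} {a b : ℝ} {μ : Measure X} (h : IsRadialShell Φ a b μ)
    (hΦ : Measurable Φ) {A : X → V} (hA : Measurable A)
    (hcont : ContinuousOn (A ∘ Φ) (Icc a b ×ˢ univ)) {K : V}
    (hK : ∀ r ∈ Icc a b, ∫ v, A (Φ (r, v)) ∂(volume : Measure E).toSphere
      = (volume : Measure E).toSphere.real univ • K) :
    Integrable A μ ∧ ∫ x, A x ∂μ = μ.real univ • K := by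
  obtain ⟨ν, hν, hab, rfl⟩ := h
  set σ := (volume : Measure E).toSphere
  have hrest : (ν.prod σ).restrict (Icc a b ×ˢ univ) = ν.prod σ := by
    rw [← Measure.prod_restrict, Measure.restrict_univ,
      Measure.restrict_eq_self_of_ae_mem (show ∀ᵐ r ∂ν, r ∈ Icc a b from hab)]
  have hint : Integrable (A ∘ Φ) (ν.prod σ) := by
    have := hcont.integrableOn_compact (μ := ν.prod σ) (isCompact_Icc.prod isCompact_univ)
    rwa [IntegrableOn, hrest] at this
  have hAm : AEStronglyMeasurable A ((ν.prod σ).map Φ) := hA.aestronglyMeasurable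
  refine ⟨(integrable_map_measure hAm hΦ.aemeasurable).2 hint, ?_⟩
  rw [integral_map hΦ.aemeasurable hAm]
  have h1 : ∫ q, A (Φ q) ∂ν.prod σ = ∫ r, ∫ v, A (Φ (r, v)) ∂σ ∂ν := integral_prod _ hint
  have h2 : ∫ r, ∫ v, A (Φ (r, v)) ∂σ ∂ν = ∫ _, σ.real univ • K ∂ν := by
    refine integral_congr_ae ?_
    filter_upwards [show ∀ᵐ r ∂ν, r ∈ Icc a b from hab] with r hr using hK r hr
  rw [h1, h2, integral_const, smul_smul]
  congr 1
  rw [Measure.real, Measure.real, Measure.real, Measure.map_apply hΦ .univ, preimage_univ,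
    ← univ_prod_univ, Measure.prod_prod, ENNReal.toReal_mul]

omit [MeasurableSpace E] [BorelSpace E] in
theorem IsTrigPair.continuousOn_attraction {κ : ℝ} {C S : ℝ → ℝ} (h : IsTrigPair κ C S)
    {V : Type*} [NormedAddCommGroup V] [NormedSpace ℝ V] (L : E →ₗ[ℝ] V) (o : V) {e : E}
    (he : ‖e‖ = 1) (m : ℕ) (G : ℝ) {s : ℝ} {I : Set ℝ}
    (hpos : ∀ r ∈ I, ∀ u ∈ Icc (-1 : ℝ) 1, 0 < sinSqSide κ C S r s u) :
    ContinuousOn (fun q : ℝ × sphere (0 : E) 1 => G • (invSinPow κ C S m q.1 s ⟪(q.2 : E), e⟫ •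
      (C q.1 • o + S q.1 • L q.2 - cosSide κ C S q.1 s ⟪(q.2 : E), e⟫ • (C s • o + S s • L e))))
      (I ×ˢ univ) := by
  have hCc := h.continuous_cos
  have hSc := h.continuous_sin
  have hL : Continuous L := L.continuous_of_finiteDimensional
  have hcos : Continuous fun q : ℝ × sphere (0 : E) 1 => cosSide κ C S q.1 s ⟪(q.2 : E), e⟫ :=
    h.continuous_cosSide.comp (f := fun q : ℝ × sphere (0 : E) 1 => (q.1, s, ⟪(q.2 : E), e⟫))
      (by fun_prop)
  have hinv : ContinuousOn (fun q : ℝ × sphere (0 : E) 1 =>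
      invSinPow κ C S m q.1 s ⟪(q.2 : E), e⟫) (I ×ˢ univ) :=
    (h.continuousOn_invSinPow m).comp
      (f := fun q : ℝ × sphere (0 : E) 1 => (q.1, s, ⟪(q.2 : E), e⟫)) (by fun_prop)
      fun q hq => hpos _ hq.1 _ (inner_mem_Icc he q.2)
  have hvec : Continuous fun q : ℝ × sphere (0 : E) 1 => C q.1 • o + S q.1 • L q.2
      - cosSide κ C S q.1 s ⟪(q.2 : E), e⟫ • (C s • o + S s • L e) := by fun_prop
  exact (hinv.smul hvec.continuousOn).const_smul G

end Shells

/-! ### The field of a uniform shell -/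

section UniformShell

variable {n : ℕ}

theorem measurable_sphDist (o : Sph n) : Measurable (sphDist o) := by
  unfold sphDist InnerProductGeometry.angle
  fun_prop

theorem measurable_hypDist (o : Hyp n) : Measurable (hypDist o) := by
  have : Measurable fun x : Hyp n => mink o.1 x.1 := by
    unfold mink
    fun_prop
  unfold hypDist Real.arcosh
  fun_prop

theorem measurable_sphAttraction (G : ℝ) (p : Sph n) : Measurable (sphAttraction G p) := by
  have := measurable_sphDist p
  unfold sphAttraction sphDir
  fun_prop

theorem measurable_hypAttraction (G : ℝ) (p : Hyp n) : Measurable (hypAttraction G p) := by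
  have := measurable_hypDist p
  unfold hypAttraction hypDir
  fun_prop

theorem IsUniformSphShell.exists_isRadialShell (hn : 1 ≤ n) {o : Sph n} {a b : ℝ}
    {μ : Measure (Sph n)} (h : IsUniformSphShell o a b μ) :
    ∃ L : SphFrame o, a ≤ b ∧ IsRadialShell (Function.uncurry (sphExp L)) a b μ := by
  rcases h with ⟨hab, ρ, rfl⟩ | ⟨rfl, ρ, L, rfl⟩
  · obtain ⟨L⟩ := sphFrame_nonempty o
    refine ⟨L, hab.le, IsRadialShell.smul ?_ ρ⟩
    rw [sphVolume_eq_map hn L]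
    exact isRadialShell_thick Real.continuous_sin measurableSet_Ioo (continuous_sphExp L).measurable
      (measurable_sphDist o) (fun r hr v => sphDist_sphExp L (Ioo_subset_Icc_self hr) v) a b
  · exact ⟨L, le_rfl, (isRadialShell_thin (continuous_sphExp L).measurable a _).smul ρ⟩

theorem IsUniformHypShell.exists_isRadialShell (hn : 1 ≤ n) {o : Hyp n} {a b : ℝ}
    {μ : Measure (Hyp n)} (h : IsUniformHypShell o a b μ) :
    ∃ L : HypFrame o, a ≤ b ∧ IsRadialShell (Function.uncurry (hypExp L)) a b μ := by
  rcases h with ⟨hab, ρ, rfl⟩ | ⟨rfl, ρ, L, rfl⟩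
  · obtain ⟨L⟩ := hypFrame_nonempty o
    refine ⟨L, hab.le, IsRadialShell.smul ?_ ρ⟩
    rw [hypVolume_eq_map hn L]
    exact isRadialShell_thick Real.continuous_sinh measurableSet_Ioi
      (continuous_hypExp L).measurable
      (measurable_hypDist o) (fun r hr v => hypDist_hypExp L (le_of_lt hr) v) a b
  · exact ⟨L, le_rfl, (isRadialShell_thin (continuous_hypExp L).measurable a _).smul ρ⟩

theorem integral_hypAttraction (hn : 1 ≤ n) {o : Hyp n} (L : HypFrame o) (G : ℝ) {r s : ℝ}
    (e : sphere (0 : EuclideanSpace ℝ (Fin n)) 1)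
    (hpos : ∀ u ∈ Icc (-1 : ℝ) 1, 0 < sinSqSide (-1) Real.cosh Real.sinh r s u) :
    ∫ v, hypAttraction G (hypExp L s e) (hypExp L r v)
        ∂(volume : Measure (EuclideanSpace ℝ (Fin n))).toSphere
      = G • (zonalAttraction (-1) Real.cosh Real.sinh (e : EuclideanSpace ℝ (Fin n)) r s •
        (Real.cosh s • L.toLin e - (-1 * Real.sinh s) • o.1)) := by
  simp only [hypAttraction_hypExp hn]
  rw [integral_smul, isTrigPair_hyperbolic.integral_attraction L.toLin o.1
    (norm_eq_of_mem_sphere e) hpos]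

theorem integral_sphAttraction (hn : 1 ≤ n) {o : Sph n} (L : SphFrame o) (G : ℝ) {r s : ℝ}
    (e : sphere (0 : EuclideanSpace ℝ (Fin n)) 1)
    (hpos : ∀ u ∈ Icc (-1 : ℝ) 1, 0 < sinSqSide 1 Real.cos Real.sin r s u) :
    ∫ v, sphAttraction G (sphExp L s e) (sphExp L r v)
        ∂(volume : Measure (EuclideanSpace ℝ (Fin n))).toSphere
      = G • (zonalAttraction 1 Real.cos Real.sin (e : EuclideanSpace ℝ (Fin n)) r s •
        (Real.cos s • L.toLin e
          - (1 * Real.sin s) • (o : EuclideanSpace ℝ (Fin (n + 1))))) := by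
  simp only [sphAttraction_sphExp hn]
  rw [integral_smul]
  exact congrArg _ (isTrigPair_sphere.integral_attraction L.toLin.toLinearMap
    (o : EuclideanSpace ℝ (Fin (n + 1))) (norm_eq_of_mem_sphere e) hpos)

theorem hypField_inside (hn : 1 ≤ n) (G : ℝ) {o : Hyp n} {a b : ℝ} {μ : Measure (Hyp n)}
    {L : HypFrame o} (h : IsRadialShell (Function.uncurry (hypExp L)) a b μ) {p : Hyp n}
    (hp : hypDist o p < a) :
    Integrable (fun x => hypAttraction G p x) μ ∧ hypField G μ p = 0 := by
  have : Nonempty (Fin n) := ⟨⟨0, hn⟩⟩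
  obtain ⟨e, he⟩ := exists_hypExp_eq hn L p
  have hs0 := hypDist_nonneg o p
  generalize hypDist o p = s at *
  subst he
  have he1 := norm_eq_of_mem_sphere e
  have hpos : ∀ r ∈ Icc a b, ∀ t ∈ Icc 0 s, ∀ u ∈ Icc (-1 : ℝ) 1,
      0 < sinSqSide (-1) Real.cosh Real.sinh r t u := fun r hr t ht u hu =>
    sinSqSide_hyperbolic_pos (by linarith [hr.1, ht.2]) (by linarith [hr.1, ht.1, ht.2]) hu
  have hpos' : ∀ r ∈ Icc a b, ∀ u ∈ Icc (-1 : ℝ) 1,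
      0 < sinSqSide (-1) Real.cosh Real.sinh r s u :=
    fun r hr => hpos r hr s (right_mem_Icc.2 hs0)
  have key := h.integral_eq (continuous_hypExp L).measurable
    (measurable_hypAttraction G (hypExp L s e))
    ((isTrigPair_hyperbolic.continuousOn_attraction L.toLin o.1 he1 _ G hpos').congr
      fun q _ => hypAttraction_hypExp hn L G q.1 s q.2 e) (K := 0) (fun r hr => by
        rw [smul_zero]
        refine (integral_hypAttraction hn L G e (hpos' r hr)).trans ?_
        rw [isTrigPair_hyperbolic.zonalAttraction_inside he1 hs0
          (fun t ht => (Real.sinh_pos_iff.2 ht.1).ne') (hpos r hr), zero_smul, smul_zero])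
  rwa [smul_zero] at key

theorem hypField_outside (hn : 1 ≤ n) (G : ℝ) {o : Hyp n} {a b : ℝ} (ha : 0 < a) (hab : a ≤ b)
    {μ : Measure (Hyp n)} {L : HypFrame o}
    (h : IsRadialShell (Function.uncurry (hypExp L)) a b μ) {p : Hyp n} (hp : b < hypDist o p) :
    Integrable (fun x => hypAttraction G p x) μ ∧
      hypField G μ p = hypField G (μ univ • Measure.dirac o) p := by
  obtain ⟨e, he⟩ := exists_hypExp_eq hn L p
  generalize hypDist o p = s at *
  subst he
  have he1 := norm_eq_of_mem_sphere e
  have hpos : ∀ r ∈ Icc 0 b, ∀ u ∈ Icc (-1 : ℝ) 1,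
      0 < sinSqSide (-1) Real.cosh Real.sinh r s u := fun r hr u hu =>
    sinSqSide_hyperbolic_pos (by linarith [hr.2]) (by linarith [hr.1]) hu
  have hS : 0 < Real.sinh s := Real.sinh_pos_iff.2 (by linarith)
  have hexp0 : ∀ v, hypExp L 0 v = o := fun v => Subtype.ext (by simp [coe_hypExp])
  have h0b : (0 : ℝ) ∈ Icc 0 b := ⟨le_rfl, by linarith⟩
  have hsub : ∀ r ∈ Icc a b, r ∈ Icc 0 b := fun r hr => ⟨by linarith [hr.1], hr.2⟩
  have hz : ∀ r ∈ Icc 0 b, zonalAttraction (-1) Real.cosh Real.sinh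
      (e : EuclideanSpace ℝ (Fin n)) r s = _ := fun r hr =>
    isTrigPair_hyperbolic.zonalAttraction_outside he1 hr.1 hS
      fun t ht => hpos t ⟨ht.1, ht.2.trans hr.2⟩
  have key := h.integral_eq (continuous_hypExp L).measurable
    (measurable_hypAttraction G (hypExp L s e))
    ((isTrigPair_hyperbolic.continuousOn_attraction L.toLin o.1 he1 _ G
      fun r hr => hpos r (hsub r hr)).congr
      fun q _ => hypAttraction_hypExp hn L G q.1 s q.2 e)
    (K := hypAttraction G (hypExp L s e) o) (fun r hr => by
        -- The right-hand side is the attraction of the sphere of radius zero.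
        have h0 := integral_hypAttraction hn L G e (hpos 0 h0b)
        simp only [hexp0, integral_const] at h0
        rw [h0, hz 0 h0b, ← hz r (hsub r hr)]
        exact integral_hypAttraction hn L G e (hpos r (hsub r hr)))
  refine ⟨key.1, key.2.trans ?_⟩
  rw [hypField, integral_smul_measure, integral_dirac]
  rfl

theorem sphDist_nonneg (x y : Sph n) : 0 ≤ sphDist x y := InnerProductGeometry.angle_nonneg _ _

theorem sphDist_neg_left (x y : Sph n) : sphDist (-x) y = Real.pi - sphDist x y := by
  rw [sphDist, coe_neg_sphere, InnerProductGeometry.angle_neg_left, sphDist]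

theorem sphDist_neg_right (x y : Sph n) : sphDist x (-y) = Real.pi - sphDist x y := by
  rw [sphDist, coe_neg_sphere, InnerProductGeometry.angle_neg_right, sphDist]

/-- The attractions at antipodal points are equal as vectors of the ambient space. -/
theorem sphAttraction_neg (G : ℝ) (p x : Sph n) : sphAttraction G (-p) x = sphAttraction G p x := by
  rw [sphAttraction, sphDir, sphDist_neg_left, Real.sin_pi_sub, Real.cos_pi_sub, coe_neg_sphere,
    neg_smul_neg]
  rfl

theorem sphField_inside (hn : 1 ≤ n) (G : ℝ) {o : Sph n} {a b : ℝ} (hab : a ≤ b)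
    (hπ : a + b ≤ Real.pi) {μ : Measure (Sph n)}
    {L : SphFrame o} (h : IsRadialShell (Function.uncurry (sphExp L)) a b μ) {p : Sph n}
    (hp : sphDist o p < a) :
    Integrable (fun x => sphAttraction G p x) μ ∧ sphField G μ p = 0 := by
  have : Nonempty (Fin n) := ⟨⟨0, hn⟩⟩
  obtain ⟨e, he⟩ := exists_sphExp_eq hn L p
  have hs0 := sphDist_nonneg o p
  generalize sphDist o p = s at *
  subst he
  have he1 := norm_eq_of_mem_sphere e
  have hpos : ∀ r ∈ Icc a b, ∀ t ∈ Icc 0 s, ∀ u ∈ Icc (-1 : ℝ) 1,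
      0 < sinSqSide 1 Real.cos Real.sin r t u := fun r hr t ht u hu => by
    obtain ⟨hr1, hr2⟩ := hr
    obtain ⟨ht1, ht2⟩ := ht
    have habs : |r - t| = r - t := abs_of_pos (by linarith)
    exact sinSqSide_sphere_pos (by linarith) (by linarith) (by linarith) (by linarith) hu
  have hpos' : ∀ r ∈ Icc a b, ∀ u ∈ Icc (-1 : ℝ) 1,
      0 < sinSqSide 1 Real.cos Real.sin r s u :=
    fun r hr => hpos r hr s (right_mem_Icc.2 hs0)
  have key := h.integral_eq (continuous_sphExp L).measurable
    (measurable_sphAttraction G (sphExp L s e))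
    ((isTrigPair_sphere.continuousOn_attraction L.toLin.toLinearMap
      (o : EuclideanSpace ℝ (Fin (n + 1))) he1 _ G hpos').congr
      fun q _ => sphAttraction_sphExp hn L G q.1 s q.2 e) (K := 0) (fun r hr => by
        rw [smul_zero]
        refine (integral_sphAttraction hn L G e (hpos' r hr)).trans ?_
        rw [isTrigPair_sphere.zonalAttraction_inside he1 hs0
          (fun t ht => (Real.sin_pos_of_mem_Ioo ⟨ht.1, by linarith [ht.2]⟩).ne') (hpos r hr),
          zero_smul, smul_zero])
  rwa [smul_zero] at key

theorem sphField_outside (hn : 1 ≤ n) (G : ℝ) {o : Sph n} {a b : ℝ} (ha : 0 < a) (hab : a ≤ b)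
    {μ : Measure (Sph n)} {L : SphFrame o}
    (h : IsRadialShell (Function.uncurry (sphExp L)) a b μ) {p : Sph n} (hp : b < sphDist o p)
    (hp' : b < sphDist (-o) p) :
    Integrable (fun x => sphAttraction G p x) μ ∧
      sphField G μ p = sphField G (μ univ • Measure.dirac o) p := by
  obtain ⟨e, he⟩ := exists_sphExp_eq hn L p
  rw [sphDist_neg_left] at hp'
  generalize sphDist o p = s at *
  subst he
  have he1 := norm_eq_of_mem_sphere e
  have hpos : ∀ r ∈ Icc 0 b, ∀ u ∈ Icc (-1 : ℝ) 1,
      0 < sinSqSide 1 Real.cos Real.sin r s u := fun r hr u hu => by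
    obtain ⟨hr1, hr2⟩ := hr
    have habs : |r - s| = s - r := by
      rw [abs_sub_comm]
      exact abs_of_pos (by linarith)
    exact sinSqSide_sphere_pos (by linarith) (by linarith) (by linarith) (by linarith) hu
  have hS : 0 < Real.sin s := Real.sin_pos_of_mem_Ioo ⟨by linarith, by linarith⟩
  have hexp0 : ∀ v, sphExp L 0 v = o := fun v => Subtype.ext (by simp [coe_sphExp])
  have h0b : (0 : ℝ) ∈ Icc 0 b := ⟨le_rfl, by linarith⟩
  have hsub : ∀ r ∈ Icc a b, r ∈ Icc 0 b := fun r hr => ⟨by linarith [hr.1], hr.2⟩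
  have hz : ∀ r ∈ Icc 0 b, zonalAttraction 1 Real.cos Real.sin
      (e : EuclideanSpace ℝ (Fin n)) r s = _ := fun r hr =>
    isTrigPair_sphere.zonalAttraction_outside he1 hr.1 hS
      fun t ht => hpos t ⟨ht.1, ht.2.trans hr.2⟩
  have key := h.integral_eq (continuous_sphExp L).measurable
    (measurable_sphAttraction G (sphExp L s e))
    ((isTrigPair_sphere.continuousOn_attraction L.toLin.toLinearMap
      (o : EuclideanSpace ℝ (Fin (n + 1))) he1 _ G fun r hr => hpos r (hsub r hr)).congr
      fun q _ => sphAttraction_sphExp hn L G q.1 s q.2 e)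
    (K := sphAttraction G (sphExp L s e) o) (fun r hr => by
        -- The right-hand side is the attraction of the sphere of radius zero.
        have h0 := integral_sphAttraction hn L G e (hpos 0 h0b)
        simp only [hexp0, integral_const] at h0
        rw [h0, hz 0 h0b, ← hz r (hsub r hr)]
        exact integral_sphAttraction hn L G e (hpos r (hsub r hr)))
  refine ⟨key.1, key.2.trans ?_⟩
  rw [sphField, integral_smul_measure, integral_dirac]
  rfl

end UniformShell

end

theorem theorem4p2 (n : ℕ) (hn : 1 ≤ n) (G : ℝ) :
    (∀ (o : Hyp n) (a b : ℝ) (μ : Measure (Hyp n)), 0 < a → IsUniformHypShell o a b μ →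
      IsFiniteMeasure μ ∧
      (∀ p : Hyp n, hypDist o p < a →
        Integrable (fun x => hypAttraction G p x) μ ∧ hypField G μ p = 0) ∧
      (∀ p : Hyp n, b < hypDist o p →
        Integrable (fun x => hypAttraction G p x) μ ∧
        hypField G μ p = hypField G (μ Set.univ • Measure.dirac o) p)) ∧
    (∀ (o : Sph n) (a b : ℝ) (μ : Measure (Sph n)), 0 < a → a + b ≤ Real.pi →
      IsUniformSphShell o a b μ →
      IsFiniteMeasure μ ∧
      (∀ p : Sph n, sphDist o p < a →
        Integrable (fun x => sphAttraction G p x) μ ∧ sphField G μ p = 0) ∧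
      (∀ p : Sph n, sphDist (-o) p < a →
        Integrable (fun x => sphAttraction G p x) μ ∧ sphField G μ p = 0) ∧
      (∀ p : Sph n, b < sphDist o p → b < sphDist (-o) p →
        Integrable (fun x => sphAttraction G p x) μ ∧
        sphField G μ p = sphField G (μ Set.univ • Measure.dirac o) p)) := by
  refine ⟨fun o a b μ ha h => ?_, fun o a b μ ha hπ h => ?_⟩
  · obtain ⟨L, hab, hL⟩ := h.exists_isRadialShell hn
    exact ⟨hL.isFiniteMeasure, fun p hp => hypField_inside hn G hL hp,
      fun p hp => hypField_outside hn G ha hab hL hp⟩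
  · obtain ⟨L, hab, hL⟩ := h.exists_isRadialShell hn
    refine ⟨hL.isFiniteMeasure, fun p hp => sphField_inside hn G hab hπ hL hp, fun p hp => ?_,
      fun p hp hp' => sphField_outside hn G ha hab hL hp hp'⟩
    have hp' : sphDist o (-p) < a := by rwa [sphDist_neg_right, ← sphDist_neg_left]
    have h' := sphField_inside hn G hab hπ hL hp'
    simpa only [sphField, sphAttraction_neg] using h'
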